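/- Let $m$ alternatives $a_1,\dots,a_m$ be given and let $\pi_1,\dots,\pi_m$ be probability densities on $\mathbb R$ that are continuous, positive everywhere, of mean $0$ and symmetric ($\pi_i(-x)=\pi_i(x)$), at least one of which is the density of a Gaussian $N(0,\sigma^2)$ with $\sigma^2>0$. In the location family $\mathrm{RUM}(\pi_1,\dots,\pi_m)$ with parameter $\vec\theta\in\mathbb R^m$, normalized by $\theta_m=0$, the utilities $u_1,\dots,u_m$ are independent, $u_i$ has density $u\mapsto\pi_i(u-\theta_i)$, and a ranking is generated by ordering the alternatives by descending utility; let $p_{ii'}(\vec\theta)=\Pr(u_i>u_{i'}\mid\vec\theta)$. A weighted breaking $\mathcal G$ assigns a weight $g_{kk'}=g_{k'k}\ge 0$ to each pair of distinct positions $k,k'\in\{1,\dots,m\}$; assume that it has at least one positive weight. It is uniform if all the $g_{kk'}$ are equal. Given rankings $P=(R_1,\dots,R_n)$, let $\kappa_{ii'}=\frac1n\sum_j g_{kk'}$, where the sum is over those $j$ for which $R_j$ ranks $a_i$ above $a_{i'}$, and $k<k'$ are the positions of $a_i$ and $a_{i'}$ in $R_j$. Let $\mathcal W_{\mathrm u}$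 be a uniform weight vector, $w_{ii'}=w>0$ for all $i\ne i'$. The estimator $\mathrm{RBCML}(\mathcal G,\mathcal W_{\mathrm u})$ returns the maximizers over $\{\vec\theta\in\mathbb R^m:\theta_m=0\}$ of the composite log-marginal likelihood $$\mathrm{CLL}(\vec\theta,P)=\sum_{i\ne i'}\kappa_{ii'}\,w_{ii'}\ln p_{ii'}(\vec\theta).$$ It is called consistent if, for every ground truth $\vec\theta_0$ with $\theta_{0,m}=0$ and every $\varepsilon>0$, the probability that a maximizer exists and all maximizers lie within distance $\varepsilon$ of $\vec\theta_0$, when $R_1,\dots,R_n$ are drawn i.i.d. from the model at $\vec\theta_0$, tends to $1$ as $n\to\infty$. Then $\mathrm{RBCML}(\mathcal G,\mathcal W_{\mathrm u})$ is consistent if and only if $\mathcal G$ is uniform. -/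

import Mathlib

open MeasureTheory ProbabilityTheory Filter Topology
open scoped ENNReal NNReal

namespace RBCML

/-- A probability density on `ℝ` that is continuous, positive everywhere, and has (finite) mean `0`:
the shape of a utility distribution. -/
structure IsUtilityShape (f : ℝ → ℝ) : Prop where
  continuous : Continuous f
  pos : ∀ x, 0 < f x
  integral_eq_one : ∫ x, f x = 1
  integrable_mul : Integrable (fun x => x * f x)
  mean_eq_zero : ∫ x, x * f x = 0

/-- A density of mean `0` is symmetric if it is symmetric around its mean. -/
def IsSymmetricShape (f : ℝ → ℝ) : Prop := ∀ x, f (-x) = f x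

/-- The density of a Gaussian distribution of mean `0` and positive variance. -/
def IsGaussianShape (f : ℝ → ℝ) : Prop := ∃ v : ℝ≥0, v ≠ 0 ∧ f = gaussianPDFReal 0 v

/-- A ranking of the alternatives `Fin m`: `R i` is the position of alternative `i`, position `0`
being the top; `i` is ranked above `j` iff `R i < R j`. -/
abbrev Ranking (m : ℕ) : Type := Equiv.Perm (Fin m)

/-- The parameters `θ` of the location family, normalized by: the last entry is `0`. -/
def paramSpace (m : ℕ) : Set (Fin m → ℝ) := {θ | ∀ i : Fin m, (i : ℕ) + 1 = m → θ i = 0}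

/-- The joint law of the utilities in the location family with shapes `π` at parameter `θ`:
they are independent, and that of alternative `i` has density `u ↦ π i (u - θ i)`. -/
noncomputable def utilityLaw {m : ℕ} (π : Fin m → ℝ → ℝ) (θ : Fin m → ℝ) : Measure (Fin m → ℝ) :=
  Measure.pi fun i => volume.withDensity fun u => ENNReal.ofReal (π i (u - θ i))

/-- The probability of generating the ranking `R`, by ranking the alternatives in descending order
of their utilities. -/
noncomputable def rankingProb {m : ℕ} (π : Fin m → ℝ → ℝ) (θ : Fin m → ℝ) (R : Ranking m) : ℝ :=
  (utilityLaw π θ).real {u | ∀ i j, R i < R j → u j < u i}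

/-- The probability that alternative `i` is ranked above alternative `j`. -/
noncomputable def pairProb {m : ℕ} (π : Fin m → ℝ → ℝ) (θ : Fin m → ℝ) (i j : Fin m) : ℝ :=
  (utilityLaw π θ).real {u | u j < u i}

/-- A preference profile of `n` rankings. -/
abbrev Profile (m n : ℕ) : Type := Fin n → Ranking m

/-- The probability of a profile of `n` i.i.d. rankings. -/
noncomputable def profileProb {m n : ℕ} (π : Fin m → ℝ → ℝ) (θ : Fin m → ℝ) (P : Profile m n) : ℝ :=
  ∏ k, rankingProb π θ (P k)

/-- The probability, under `n` i.i.d. rankings, of a set of profiles. -/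
noncomputable def profileEventProb {m n : ℕ} (π : Fin m → ℝ → ℝ) (θ : Fin m → ℝ)
    (E : Set (Profile m n)) : ℝ :=
  ∑ P : Profile m n, E.indicator (profileProb π θ) P

/-- A weighted breaking: an undirected graph on the positions with nonnegative edge weights,
weight `0` meaning that there is no edge. Diagonal values are never used. -/
structure Breaking (m : ℕ) where
  weight : Fin m → Fin m → ℝ
  symm : ∀ k l, weight k l = weight l k
  nonneg : ∀ k l, 0 ≤ weight k l

/-- The breaking has at least one edge. -/
def Breaking.HasEdge {m : ℕ} (G : Breaking m) : Prop := ∃ k l, k ≠ l ∧ 0 < G.weight k l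

/-- All weights of the breaking are the same. -/
def Breaking.IsUniform {m : ℕ} (G : Breaking m) : Prop := ∃ c, ∀ k l, k ≠ l → G.weight k l = c

/-- A vector of composite marginal likelihood weights: a nonnegative weight for each ordered pair
of distinct alternatives. Diagonal values are never used. -/
structure CMLWeights (m : ℕ) where
  weight : Fin m → Fin m → ℝ
  nonneg : ∀ i j, 0 ≤ weight i j

/-- All weights are equal (to a positive number). -/
def CMLWeights.IsUniform {m : ℕ} (W : CMLWeights m) : Prop :=
  ∃ c, 0 < c ∧ ∀ i j, i ≠ j → W.weight i j = c

/-- The weight that the breaking extracts from `R` for the comparison "`i` above `j`". -/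
noncomputable def Breaking.comparison {m : ℕ} (G : Breaking m) (R : Ranking m) (i j : Fin m) : ℝ :=
  if R i < R j then G.weight (R i) (R j) else 0

/-- The average weight `κ i j` of the comparison "`i` above `j`" in the profile. -/
noncomputable def Breaking.kappa {m n : ℕ} (G : Breaking m) (P : Profile m n) (i j : Fin m) : ℝ :=
  (∑ k, G.comparison (P k) i j) / n

/-- The composite log-marginal likelihood. -/
noncomputable def cll {m n : ℕ} (G : Breaking m) (W : CMLWeights m) (π : Fin m → ℝ → ℝ)
    (P : Profile m n) (θ : Fin m → ℝ) : ℝ :=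
  ∑ i, ∑ j, if i ≠ j then G.kappa P i j * W.weight i j * Real.log (pairProb π θ i j) else 0

/-- The output of the estimator on a profile: the set of all maximizers, over the parameter space,
of the composite log-marginal likelihood. -/
def estimator {m n : ℕ} (G : Breaking m) (W : CMLWeights m) (π : Fin m → ℝ → ℝ)
    (P : Profile m n) : Set (Fin m → ℝ) :=
  {θ | θ ∈ paramSpace m ∧ IsMaxOn (cll G W π P) (paramSpace m) θ}

/-- Consistency: for each ground truth `θ₀` in the parameter space, the estimate exists with
probability tending to `1` and converges in probability to `θ₀` as the number of rankings grows,
whichever maximizers are taken where there are several. -/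
def IsConsistent {m : ℕ} (G : Breaking m) (W : CMLWeights m) (π : Fin m → ℝ → ℝ) : Prop :=
  ∀ θ₀ ∈ paramSpace m, ∀ ε > 0,
    Tendsto (fun n : ℕ => profileEventProb π θ₀
      {P : Profile m n | (estimator G W π P).Nonempty ∧ ∀ θ ∈ estimator G W π P, dist θ θ₀ < ε})
      atTop (𝓝 1)

end RBCML

/-! Write each utility as noise plus location, so that all parameters live on one noise space. By
the law of large numbers the average weights `κ` converge in probability to the expected weights at
the ground truth, and consistency becomes a question about the maximizers of `logLik` for `κ` near
this limit.

Uniform breakings. If all weights equal `c`, the limit of `κ i j` is `c` times the pair probability.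
Gibbs' inequality (`logLik_lt_of_ne`) makes the ground truth the unique maximizer of the limit.
Coercivity confines competitors to a compact box, so uniqueness survives small perturbations of `κ`
(`eventually_maximizers`).

Necessity. By continuity, consistency forces every ground truth to maximize its own limit likelihood
(`IsConsistent.logLik_le`). Differentiating in the coordinate of the Gaussian alternative `g` gives,
at every `θ`, a vanishing sum over `j`: a positive density times the difference between the mean
weight given that `g` beats `j` and the mean weight given that `j` beats `g`.

Two limits extract single weights from this identity. Sending `k` alternatives far up and others far
down leaves the same identity for `g` and `d` opponents, with positions offset by `k`
(`FirstOrderCondition.restrict`). Then `g` itself is sent up. Given that it beats `j`, it is almost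
surely first. Given that it loses to `j`, the light Gaussian tail makes a second defeat negligible,
so the positions are `k` and `k + 1` (`tendsto_beaten_twice`). If `w k (k + r) = w k (k + 1)` for
all `r < d`, every term eventually has the sign of `w k (k + d) - w k (k + 1)`, which must therefore
be zero (`FirstOrderCondition.weight_eq_of_lt`).

Thus a weight depends only on its upper position. Symmetry of the noise turns rankings upside down,
so it also depends only on its lower position; together these make the breaking uniform. -/

namespace RBCML

/-! ### Pair probabilities and expected weights on the noise space -/

section Noise

variable {m : ℕ} {ν : Fin m → Measure ℝ}

/-- The probability that `i` has a larger utility than `j` when the noise terms are independent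
with laws `ν`. -/
noncomputable def noisePairProb (ν : Fin m → Measure ℝ) (θ : Fin m → ℝ) (i j : Fin m) : ℝ :=
  (Measure.pi ν).real {ξ | ξ j + θ j < ξ i + θ i}

/-- The number of alternatives of `T` whose utility exceeds that of `i`. -/
noncomputable def posIn (T : Finset (Fin m)) (u : Fin m → ℝ) (i : Fin m) : ℕ :=
  (T.filter fun i' => u i < u i').card

/-- The weight of the comparison "`i` above `j`", given the utilities `u`, if the weight of two
positions is given by `w`. -/
noncomputable def utilComparison (T : Finset (Fin m)) (w : ℕ → ℕ → ℝ) (u : Fin m → ℝ)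
    (i j : Fin m) : ℝ :=
  if u j < u i then w (posIn T u i) (posIn T u j) else 0

/-- The expected weight of the comparison "`i` above `j`". -/
noncomputable def expComparison (ν : Fin m → Measure ℝ) (T : Finset (Fin m)) (w : ℕ → ℕ → ℝ)
    (θ : Fin m → ℝ) (i j : Fin m) : ℝ :=
  ∫ ξ, utilComparison T w (ξ + θ) i j ∂Measure.pi ν

lemma measurable_posIn (T : Finset (Fin m)) (i : Fin m) :
    Measurable fun u : Fin m → ℝ => posIn T u i := by
  simp only [posIn, Finset.card_filter]
  refine Finset.measurable_sum _ fun i' _ => ?_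
  exact Measurable.ite (measurableSet_lt (by fun_prop) (by fun_prop)) measurable_const
    measurable_const

lemma measurable_utilComparison (T : Finset (Fin m)) (w : ℕ → ℕ → ℝ) (i j : Fin m) :
    Measurable fun u : Fin m → ℝ => utilComparison T w u i j := by
  refine Measurable.ite (measurableSet_lt (by fun_prop) (by fun_prop)) ?_ measurable_const
  have h : Measurable (Function.uncurry w) := measurable_of_countable _
  exact h.comp ((measurable_posIn T i).prodMk (measurable_posIn T j))

/-- The indicator is kept because, once integrated, it bounds the expected weight by `C` times the
pair probability; quotients of the two then stay bounded even where that probability tends to zero.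
-/
lemma abs_utilComparison_le {T : Finset (Fin m)} {w : ℕ → ℕ → ℝ} {C : ℝ}
    (hw : ∀ a b, |w a b| ≤ C) (u : Fin m → ℝ) (i j : Fin m) :
    |utilComparison T w u i j| ≤ {u : Fin m → ℝ | u j < u i}.indicator (fun _ => C) u := by
  by_cases h : u j < u i
  · simp [utilComparison, h, hw]
  · simp [utilComparison, h]

lemma measurableSet_pair (θ : Fin m → ℝ) (i j : Fin m) :
    MeasurableSet {ξ : Fin m → ℝ | ξ j + θ j < ξ i + θ i} :=
  measurableSet_lt (by fun_prop) (by fun_prop)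

lemma expComparison_const (T : Finset (Fin m)) (c : ℝ) (θ : Fin m → ℝ) (i j : Fin m) :
    expComparison ν T (fun _ _ => c) θ i j = c * noisePairProb ν θ i j := by
  have : (fun ξ : Fin m → ℝ => utilComparison T (fun _ _ => c) (ξ + θ) i j)
      = {ξ : Fin m → ℝ | ξ j + θ j < ξ i + θ i}.indicator (fun _ => c) := by
    ext ξ; simp [utilComparison, Set.indicator]
  rw [expComparison, this, integral_indicator_const _ (measurableSet_pair θ i j), noisePairProb,
    smul_eq_mul, mul_comm]

lemma noisePairProb_nonneg (θ : Fin m → ℝ) (i j : Fin m) : 0 ≤ noisePairProb ν θ i j :=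
  measureReal_nonneg

lemma noisePairProb_congr {θ θ' : Fin m → ℝ} {i j : Fin m} (h : θ i - θ j = θ' i - θ' j) :
    noisePairProb ν θ i j = noisePairProb ν θ' i j := by
  unfold noisePairProb
  congr 1; ext ξ; simp only [Set.mem_ofPred_eq]
  constructor <;> intro h' <;> linarith

variable [∀ i, IsProbabilityMeasure (ν i)]

lemma integrable_utilComparison (T : Finset (Fin m)) {w : ℕ → ℕ → ℝ} {C : ℝ}
    (hw : ∀ a b, |w a b| ≤ C) (θ : Fin m → ℝ) (i j : Fin m) :
    Integrable (fun ξ => utilComparison T w (ξ + θ) i j) (Measure.pi ν) := by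
  refine Integrable.of_bound (C := C)
    ((measurable_utilComparison T w i j).comp (by fun_prop)).aestronglyMeasurable ?_
  refine ae_of_all _ fun ξ => (abs_utilComparison_le hw _ i j).trans ?_
  exact Set.indicator_le_self' (fun _ _ => (abs_nonneg _).trans (hw 0 0)) _

lemma abs_expComparison_le (T : Finset (Fin m)) {w : ℕ → ℕ → ℝ} {C : ℝ}
    (hw : ∀ a b, |w a b| ≤ C) (θ : Fin m → ℝ) (i j : Fin m) :
    |expComparison ν T w θ i j| ≤ C * noisePairProb ν θ i j := by
  calc |expComparison ν T w θ i j|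
      ≤ ∫ ξ, |utilComparison T w (ξ + θ) i j| ∂Measure.pi ν := abs_integral_le_integral_abs
    _ ≤ ∫ ξ, {ξ : Fin m → ℝ | ξ j + θ j < ξ i + θ i}.indicator (fun _ => C) ξ ∂Measure.pi ν := by
        refine integral_mono (integrable_utilComparison T hw θ i j).abs
          ((integrable_const C).indicator (measurableSet_pair θ i j)) fun ξ => ?_
        simpa [Set.indicator] using abs_utilComparison_le hw (ξ + θ) i j
    _ = C * noisePairProb ν θ i j := by
        rw [integral_indicator_const _ (measurableSet_pair θ i j), noisePairProb, smul_eq_mul,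
          mul_comm]

lemma expComparison_sub (T : Finset (Fin m)) {w w' : ℕ → ℕ → ℝ} {C C' : ℝ}
    (hw : ∀ a b, |w a b| ≤ C) (hw' : ∀ a b, |w' a b| ≤ C') (θ : Fin m → ℝ) (i j : Fin m) :
    expComparison ν T (fun a b => w a b - w' a b) θ i j
      = expComparison ν T w θ i j - expComparison ν T w' θ i j := by
  rw [expComparison, expComparison, expComparison, ← integral_sub
    (integrable_utilComparison T hw θ i j) (integrable_utilComparison T hw' θ i j)]
  congr 1 with ξ
  simp only [utilComparison]
  split_ifs <;> simp

lemma iIndepFun_noise : iIndepFun (fun i (ξ : Fin m → ℝ) => ξ i) (Measure.pi ν) :=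
  iIndepFun_pi (X := fun _ => id) fun _ => aemeasurable_id

lemma map_noise_pair {i j : Fin m} (hij : i ≠ j) :
    (Measure.pi ν).map (fun ξ => (ξ i, ξ j)) = (ν i).prod (ν j) := by
  have h := (indepFun_iff_map_prod_eq_prod_map_map (measurable_pi_apply i).aemeasurable
    (measurable_pi_apply j).aemeasurable).1
    ((iIndepFun_noise (ν := ν)).indepFun hij)
  rw [h, (measurePreserving_eval ν i).map_eq, (measurePreserving_eval ν j).map_eq]

lemma noise_real_inter {i j : Fin m} (hij : i ≠ j) {A B : Set ℝ} (hA : MeasurableSet A)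
    (hB : MeasurableSet B) :
    (Measure.pi ν).real {ξ | ξ i ∈ A ∧ ξ j ∈ B} = (ν i).real A * (ν j).real B := by
  have : {ξ : Fin m → ℝ | ξ i ∈ A ∧ ξ j ∈ B} = (fun ξ : Fin m → ℝ => (ξ i, ξ j)) ⁻¹' (A ×ˢ B) := by
    ext; simp
  rw [this, ← map_measureReal_apply (by fun_prop) (hA.prod hB), map_noise_pair hij,
    measureReal_prod_prod]

lemma noise_real_eval (i : Fin m) {A : Set ℝ} (hA : MeasurableSet A) :
    (Measure.pi ν).real {ξ | ξ i ∈ A} = (ν i).real A := by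
  rw [← (measurePreserving_eval ν i).map_eq, map_measureReal_apply (by fun_prop) hA]
  rfl

lemma noisePairProb_le_one (θ : Fin m → ℝ) (i j : Fin m) : noisePairProb ν θ i j ≤ 1 :=
  measureReal_le_one

/-- The probability that `i` beats `j` is small if `θ i` is far below `θ j`. -/
lemma exists_noisePairProb_lt {i j : Fin m} {ε : ℝ} (hε : 0 < ε) :
    ∃ B : ℝ, ∀ θ : Fin m → ℝ, θ i - θ j ≤ -B → noisePairProb ν θ i j < ε := by
  have h : Tendsto (fun t : ℝ => (Measure.pi ν).real {ξ : Fin m → ℝ | ξ j + t < ξ i}) atTop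
      (𝓝 ((Measure.pi ν).real ∅)) := by
    refine (ENNReal.tendsto_toReal (measure_ne_top _ _)).comp
      (tendsto_measure_of_ae_tendsto_indicator_of_isFiniteMeasure atTop MeasurableSet.empty
        (fun t => measurableSet_lt (by fun_prop) (by fun_prop)) ?_)
    refine ae_of_all _ fun ξ => ?_
    filter_upwards [eventually_ge_atTop (ξ i - ξ j)] with t ht
    simp only [Set.mem_empty_iff_false, iff_false, not_lt]
    linarith
  rw [measureReal_empty] at h
  obtain ⟨B, hB⟩ := (h.eventually (gt_mem_nhds hε)).exists
  refine ⟨B, fun θ hθ => lt_of_le_of_lt (measureReal_mono fun ξ hξ => ?_) hB⟩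
  simp only [Set.mem_ofPred_eq] at hξ ⊢
  linarith

section OpenPos

variable [∀ i, (ν i).IsOpenPosMeasure]

lemma noise_real_pos_of_isOpen {s : Set (Fin m → ℝ)} (hs : IsOpen s) (hne : s.Nonempty) :
    0 < (Measure.pi ν).real s :=
  ENNReal.toReal_pos (hs.measure_pos _ hne).ne' (measure_ne_top _ _)

lemma noisePairProb_pos (θ : Fin m → ℝ) {i j : Fin m} (hij : i ≠ j) :
    0 < noisePairProb ν θ i j := by
  refine noise_real_pos_of_isOpen (isOpen_lt (by fun_prop) (by fun_prop))
    ⟨Function.update 0 i (θ j - θ i + 1), ?_⟩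
  simp only [Set.mem_ofPred_eq, Function.update_self, Function.update_of_ne hij.symm, Pi.zero_apply]
  linarith

/-- Increasing the difference of locations enlarges the winning event, and the gain contains the
open set `t` on which the outcome flips. A noise difference midway between the two thresholds shows
that `t` is nonempty. -/
lemma noisePairProb_strictMono {θ θ' : Fin m → ℝ} {i j : Fin m} (hij : i ≠ j)
    (h : θ i - θ j < θ' i - θ' j) : noisePairProb ν θ i j < noisePairProb ν θ' i j := by
  set s := {ξ : Fin m → ℝ | ξ j + θ j < ξ i + θ i}
  set t := {ξ : Fin m → ℝ | ξ i + θ i < ξ j + θ j} ∩ {ξ : Fin m → ℝ | ξ j + θ' j < ξ i + θ' i}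
  have ht : IsOpen t := (isOpen_lt (by fun_prop) (by fun_prop)).inter
    (isOpen_lt (by fun_prop) (by fun_prop))
  have hpos : 0 < (Measure.pi ν).real t := by
    refine noise_real_pos_of_isOpen ht
      ⟨Function.update 0 i (((θ j - θ i) + (θ' j - θ' i)) / 2), ?_, ?_⟩ <;>
    simp only [Set.mem_ofPred_eq, Function.update_self, Function.update_of_ne hij.symm,
      Pi.zero_apply] <;> linarith
  have hd : Disjoint s t := by
    rw [Set.disjoint_left]
    rintro ξ h1 ⟨h2, -⟩
    exact lt_asymm (show ξ j + θ j < ξ i + θ i from h1) h2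
  calc noisePairProb ν θ i j < (Measure.pi ν).real s + (Measure.pi ν).real t :=
        lt_add_of_pos_right _ hpos
    _ = (Measure.pi ν).real (s ∪ t) := (measureReal_union hd ht.measurableSet).symm
    _ ≤ noisePairProb ν θ' i j := measureReal_mono (by
        rintro ξ (h1 | h1)
        · simp only [s, Set.mem_ofPred_eq] at h1 ⊢
          linarith
        · exact h1.2)

end OpenPos

variable [∀ i, NullSingletonClass (ν i)]

/-- By Fubini: once one noise term is fixed, a tie forces the other to hit a single point, which is
a null set. -/
lemma ae_noise_ne {i j : Fin m} (hij : i ≠ j) (θ : Fin m → ℝ) :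
    ∀ᵐ ξ ∂Measure.pi ν, ξ i + θ i ≠ ξ j + θ j := by
  have hs : MeasurableSet {p : ℝ × ℝ | p.1 + θ i = p.2 + θ j} :=
    measurableSet_eq_fun (by fun_prop) (by fun_prop)
  have h0 : ((ν i).prod (ν j)) {p : ℝ × ℝ | p.1 + θ i = p.2 + θ j} = 0 := by
    rw [Measure.measure_prod_null hs]
    refine ae_of_all _ fun x => ?_
    have : Prod.mk x ⁻¹' {p : ℝ × ℝ | p.1 + θ i = p.2 + θ j} = {x + θ i - θ j} := by
      ext y; simp only [Set.mem_preimage, Set.mem_ofPred_eq, Set.mem_singleton_iff]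
      constructor <;> intro h <;> linarith
    simp [this]
  rw [← map_noise_pair hij, Measure.map_apply (by fun_prop) hs] at h0
  rw [ae_iff]
  simpa using h0

lemma ae_noise_injective (θ : Fin m → ℝ) :
    ∀ᵐ ξ ∂Measure.pi ν, Function.Injective (ξ + θ) := by
  have : ∀ᵐ ξ ∂Measure.pi ν, ∀ i j, i ≠ j → ξ i + θ i ≠ ξ j + θ j := by
    simp only [ae_all_iff]
    exact fun i j hij => ae_noise_ne hij θ
  filter_upwards [this] with ξ h i j hij
  by_contra hne
  exact h i j hne hij

lemma noisePairProb_add_swap (θ : Fin m → ℝ) {i j : Fin m} (hij : i ≠ j) :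
    noisePairProb ν θ i j + noisePairProb ν θ j i = 1 := by
  have h : (Measure.pi ν).real {ξ | ξ i + θ i < ξ j + θ j}
      = (Measure.pi ν).real {ξ | ξ j + θ j < ξ i + θ i}ᶜ := by
    refine measureReal_congr ?_
    filter_upwards [ae_noise_ne hij θ] with ξ hξ
    simp only [eq_iff_iff]
    change ξ i + θ i < ξ j + θ j ↔ ¬ (ξ j + θ j < ξ i + θ i)
    rw [not_lt]
    exact ⟨le_of_lt, fun h => lt_of_le_of_ne h hξ⟩
  rw [noisePairProb, noisePairProb, h, probReal_compl_eq_one_sub (measurableSet_pair θ i j)]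
  ring

/-- Away from ties, which are null, the outcome of the comparison is unchanged by small changes of
`θ`, so the indicators converge almost everywhere. -/
lemma continuous_noisePairProb {i j : Fin m} (hij : i ≠ j) :
    Continuous fun θ : Fin m → ℝ => noisePairProb ν θ i j := by
  rw [continuous_iff_continuousAt]
  intro θ
  refine (ENNReal.tendsto_toReal (measure_ne_top _ _)).comp
    (tendsto_measure_of_ae_tendsto_indicator_of_isFiniteMeasure (𝓝 θ) (measurableSet_pair θ i j)
      (fun θ' => measurableSet_pair θ' i j) ?_)
  filter_upwards [ae_noise_ne hij θ] with ξ hξ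
  have hc : Continuous fun θ' : Fin m → ℝ => ξ i + θ' i - (ξ j + θ' j) := by fun_prop
  rcases lt_or_gt_of_ne hξ with h | h
  · have h0 : ξ i + θ i - (ξ j + θ j) < 0 := by linarith
    filter_upwards [hc.continuousAt.eventually (gt_mem_nhds h0)] with θ' h'
    constructor <;> intro h <;> linarith
  · have h0 : 0 < ξ i + θ i - (ξ j + θ j) := by linarith
    filter_upwards [hc.continuousAt.eventually (lt_mem_nhds h0)] with θ' h'
    constructor <;> intro h <;> linarith

end Noise

/-! ### Law of large numbers for profiles -/

section LawOfLargeNumbers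

variable {α : Type*} [Fintype α] [MeasurableSpace α] [DiscreteMeasurableSpace α]

lemma infinitePi_real_prefix {ρ : Measure α} [IsProbabilityMeasure ρ] {n : ℕ} (P : Fin n → α) :
    (Measure.infinitePi fun _ : ℕ => ρ).real ((fun ω (k : Fin n) => ω k) ⁻¹' {P})
      = ∏ k, ρ.real {P k} := by
  have : (fun ω (k : Fin n) => ω k) ⁻¹' {P} = Set.pi (Finset.range n)
      (fun i => if h : i < n then {P ⟨i, h⟩} else (Set.univ : Set α)) := by
    ext ω
    simp only [Set.mem_preimage, Set.mem_singleton_iff, funext_iff, Set.mem_pi, Finset.coe_range,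
      Set.mem_Iio, Fin.forall_iff]
    refine forall₂_congr fun i hi => ?_
    simp [hi]
  rw [this, measureReal_def, Measure.infinitePi_pi _ fun i _ => (Set.toFinite _).measurableSet,
    Finset.prod_range, ENNReal.toReal_prod]
  simp [measureReal_def]

/-- Realizes the profiles of all sizes on a single infinite product space, where the strong law
applies. -/
lemma sum_indicator_prod_eq {ρ : Measure α} [IsProbabilityMeasure ρ] {n : ℕ}
    (E : Set (Fin n → α)) :
    ∑ P, E.indicator (fun P => ∏ k, ρ.real {P k}) P
      = (Measure.infinitePi fun _ : ℕ => ρ).real ((fun ω (k : Fin n) => ω k) ⁻¹' E) := by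
  classical
  have hm : Measurable fun (ω : ℕ → α) (k : Fin n) => ω k := by fun_prop
  have hE : E = ⋃ P ∈ E.toFinset, {P} := by ext; simp
  have h : (Measure.infinitePi fun _ : ℕ => ρ).real ((fun ω (k : Fin n) => ω k) ⁻¹' E)
      = ∑ P ∈ E.toFinset, (Measure.infinitePi fun _ : ℕ => ρ).real
        ((fun ω (k : Fin n) => ω k) ⁻¹' {P}) := by
    conv_lhs => rw [hE, Set.preimage_iUnion₂]
    refine measureReal_biUnion_finset ?_ fun P _ => hm (measurableSet_singleton P)
    intro P _ P' _ hne
    exact Disjoint.preimage _ (Set.disjoint_singleton.2 hne)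
  rw [h, ← Finset.sum_subset (Finset.subset_univ E.toFinset)]
  · refine Finset.sum_congr rfl fun P hP => ?_
    rw [Set.indicator_of_mem (by simpa using hP), infinitePi_real_prefix]
  · intro P _ hP
    exact Set.indicator_of_notMem (by simpa using hP) _

/-- The law of large numbers for i.i.d. draws from a finite type. -/
lemma tendsto_sum_indicator_mean_mem {ι : Type*} [Finite ι] {q : α → ℝ} (hq : ∀ a, 0 ≤ q a)
    (hq1 : ∑ a, q a = 1) (c : α → ι → ℝ) {V : Set (ι → ℝ)}
    (hV : V ∈ 𝓝 (fun i => ∑ a, q a * c a i)) :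
    Tendsto (fun n : ℕ => ∑ P : Fin n → α,
      {P | (fun i => (∑ k, c (P k) i) / n) ∈ V}.indicator (fun P => ∏ k, q (P k)) P)
      atTop (𝓝 1) := by
  set ρ : Measure α := ∑ a, ENNReal.ofReal (q a) • Measure.dirac a with hρ
  have hρa : ∀ a, ρ {a} = ENNReal.ofReal (q a) := by
    intro a
    rw [hρ, Measure.finsetSum_apply, Finset.sum_eq_single a] <;> simp +contextual
  have hρr : ∀ a, ρ.real {a} = q a := fun a => by
    rw [measureReal_def, hρa, ENNReal.toReal_ofReal (hq a)]
  have hp : IsProbabilityMeasure ρ := ⟨by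
    simp [hρ, Measure.finsetSum_apply, ← ENNReal.ofReal_sum_of_nonneg fun a _ => hq a, hq1]⟩
  set Pr := Measure.infinitePi fun _ : ℕ => ρ
  have hlln : ∀ᵐ ω ∂Pr, ∀ i, Tendsto (fun n : ℕ => (∑ k ∈ Finset.range n, c (ω k) i) / n) atTop
      (𝓝 (∑ a, q a * c a i)) := by
    rw [ae_all_iff]
    intro i
    have hmeas : Measurable fun a => c a i := Measurable.of_discrete
    have hev : ∀ k, MeasurePreserving (fun ω : ℕ → α => ω k) Pr ρ := fun k =>
      measurePreserving_eval_infinitePi (fun _ : ℕ => ρ) k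
    have hint : Integrable (fun a => c a i) ρ := Integrable.of_finite
    have h := strong_law_ae_real (μ := Pr) (fun k ω => c (ω k) i)
      ((hev 0).integrable_comp_of_integrable hint)
      (fun k l hkl => (iIndepFun_infinitePi (P := fun _ : ℕ => ρ) (X := fun _ a => c a i)
        (fun _ => hmeas)).indepFun hkl)
      (fun k => by
        refine ⟨(hmeas.comp (measurable_pi_apply k)).aemeasurable,
          (hmeas.comp (measurable_pi_apply 0)).aemeasurable, ?_⟩
        have hk : ∀ k, Measure.map (fun ω : ℕ → α => c (ω k) i) Pr = ρ.map (fun a => c a i) := by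
          intro k
          rw [← (hev k).map_eq, Measure.map_map hmeas (hev k).measurable]
          rfl
        rw [hk, hk])
    have hE : ∫ ω, c (ω 0) i ∂Pr = ∑ a, q a * c a i := by
      rw [← integral_map (φ := fun ω : ℕ → α => ω 0) (f := fun a => c a i)
        (hev 0).measurable.aemeasurable hmeas.aestronglyMeasurable, (hev 0).map_eq,
        integral_fintype hint]
      simp [hρr]
    simpa only [hE] using h
  have hset : ∀ n : ℕ, MeasurableSet ((fun (ω : ℕ → α) (k : Fin n) => ω k) ⁻¹'
      {P | (fun i => (∑ k, c (P k) i) / n) ∈ V}) := fun n =>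
    (measurable_pi_lambda _ fun k => measurable_pi_apply _) (Set.toFinite _).measurableSet
  have hlim : Tendsto (fun n : ℕ => Pr.real ((fun (ω : ℕ → α) (k : Fin n) => ω k) ⁻¹'
      {P | (fun i => (∑ k, c (P k) i) / n) ∈ V})) atTop (𝓝 (Pr.real Set.univ)) := by
    refine (ENNReal.tendsto_toReal (measure_ne_top _ _)).comp
      (tendsto_measure_of_ae_tendsto_indicator_of_isFiniteMeasure atTop MeasurableSet.univ hset ?_)
    filter_upwards [hlln] with ω hω
    filter_upwards [(tendsto_pi_nhds.2 hω).eventually hV] with n hn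
    have hn' : (fun i => (∑ k ∈ Finset.range n, c (ω k) i) / (n : ℝ)) ∈ V := hn
    simp only [← Fin.sum_univ_eq_sum_range (fun k => c (ω k) _)] at hn'
    exact iff_of_true hn' (Set.mem_univ _)
  rw [probReal_univ] at hlim
  refine hlim.congr fun n => ?_
  rw [← sum_indicator_prod_eq]
  simp only [hρr]

end LawOfLargeNumbers

/-! ### From densities to noise laws -/

section Shape

/-- The probability measure with density `f`. -/
noncomputable def shapeLaw (f : ℝ → ℝ) : Measure ℝ :=
  volume.withDensity fun x => ENNReal.ofReal (f x)

lemma IsUtilityShape.measurable_ofReal {f : ℝ → ℝ} (hf : IsUtilityShape f) :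
    Measurable fun x => ENNReal.ofReal (f x) :=
  hf.continuous.measurable.ennreal_ofReal

lemma IsUtilityShape.isProbabilityMeasure {f : ℝ → ℝ} (hf : IsUtilityShape f) :
    IsProbabilityMeasure (shapeLaw f) := by
  have hint : Integrable f := by
    by_contra h
    simpa [integral_undef h] using hf.integral_eq_one
  refine ⟨?_⟩
  rw [shapeLaw, withDensity_apply _ MeasurableSet.univ, Measure.restrict_univ,
    ← ofReal_integral_eq_lintegral_ofReal hint (ae_of_all _ fun x => (hf.pos x).le),
    hf.integral_eq_one, ENNReal.ofReal_one]

lemma nullSingletonClass_shapeLaw (f : ℝ → ℝ) : NullSingletonClass (shapeLaw f) :=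
  ⟨fun x => withDensity_absolutelyContinuous _ _ (measure_singleton x)⟩

lemma IsUtilityShape.isOpenPosMeasure {f : ℝ → ℝ} (hf : IsUtilityShape f) :
    (shapeLaw f).IsOpenPosMeasure :=
  (withDensity_absolutelyContinuous' hf.measurable_ofReal.aemeasurable
    (ae_of_all _ fun x => by simpa using hf.pos x)).isOpenPosMeasure

lemma IsSymmetricShape.map_neg {f : ℝ → ℝ} (hf : IsSymmetricShape f) :
    (shapeLaw f).map (fun x => -x) = shapeLaw f := by
  ext s hs
  rw [Measure.map_apply measurable_neg hs, shapeLaw, withDensity_apply _ hs,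
    withDensity_apply _ (measurable_neg hs),
    ← (Measure.measurePreserving_neg (volume : Measure ℝ)).setLIntegral_comp_preimage_emb
      (MeasurableEquiv.neg ℝ).measurableEmbedding]
  rw [Set.preimage_preimage]
  simp only [neg_neg, hf _, Set.preimage_id']

lemma shapeLaw_gaussian {v : ℝ≥0} (hv : v ≠ 0) :
    shapeLaw (gaussianPDFReal 0 v) = gaussianReal 0 v := by
  rw [gaussianReal_of_var_ne_zero _ hv]
  rfl

lemma map_add_shapeLaw {f : ℝ → ℝ} (hf : Measurable f) (c : ℝ) :
    (shapeLaw f).map (fun x => x + c) = volume.withDensity fun u => ENNReal.ofReal (f (u - c)) := by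
  ext s hs
  rw [Measure.map_apply (by fun_prop) hs, shapeLaw, withDensity_apply _ hs,
    withDensity_apply _ ((measurable_add_const c) hs),
    ← (measurePreserving_add_right (volume : Measure ℝ) c).setLIntegral_comp_preimage hs
      (by fun_prop)]
  simp

variable {m : ℕ} {π : Fin m → ℝ → ℝ}

/-- The laws of the noise terms of the utilities. -/
noncomputable def noiseLaw (π : Fin m → ℝ → ℝ) (i : Fin m) : Measure ℝ := shapeLaw (π i)

lemma utilityLaw_eq_map (hπ : ∀ i, IsUtilityShape (π i)) (θ : Fin m → ℝ) :
    utilityLaw π θ = (Measure.pi (noiseLaw π)).map (fun ξ => ξ + θ) := by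
  have : ∀ i, IsProbabilityMeasure (shapeLaw (π i)) := fun i => (hπ i).isProbabilityMeasure
  have h : ∀ i, volume.withDensity (fun u => ENNReal.ofReal (π i (u - θ i)))
      = (shapeLaw (π i)).map (fun x => x + θ i) := fun i =>
    (map_add_shapeLaw (hπ i).continuous.measurable (θ i)).symm
  have : ∀ i, IsProbabilityMeasure ((shapeLaw (π i)).map (fun x => x + θ i)) := fun i =>
    Measure.isProbabilityMeasure_map (by fun_prop)
  simp only [utilityLaw, h]
  rw [← Measure.pi_map_pi (fun i => by fun_prop)]
  rfl

lemma utilityLaw_real (hπ : ∀ i, IsUtilityShape (π i)) (θ : Fin m → ℝ) {s : Set (Fin m → ℝ)}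
    (hs : MeasurableSet s) :
    (utilityLaw π θ).real s = (Measure.pi (noiseLaw π)).real {ξ | ξ + θ ∈ s} := by
  rw [utilityLaw_eq_map hπ, map_measureReal_apply (by fun_prop) hs]
  rfl

lemma pairProb_eq (hπ : ∀ i, IsUtilityShape (π i)) (θ : Fin m → ℝ) (i j : Fin m) :
    pairProb π θ i j = noisePairProb (noiseLaw π) θ i j :=
  utilityLaw_real hπ θ (measurableSet_lt (by fun_prop) (by fun_prop))

end Shape

/-! ### Rankings generated by utilities -/

section RandomRanking

variable {m : ℕ} {π : Fin m → ℝ → ℝ}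

lemma posIn_lt_posIn {T : Finset (Fin m)} {u : Fin m → ℝ} {i j : Fin m} (hi : i ∈ T)
    (h : u j < u i) : posIn T u i < posIn T u j := by
  refine Finset.card_lt_card (Finset.ssubset_iff_of_subset ?_ |>.2 ⟨i, ?_, ?_⟩)
  · intro a
    simp only [Finset.mem_filter]
    exact fun h' => ⟨h'.1, h.trans h'.2⟩
  · simp [hi, h]
  · simp

lemma posIn_lt_card {T : Finset (Fin m)} {u : Fin m → ℝ} {i : Fin m} (hi : i ∈ T) :
    posIn T u i < T.card :=
  Finset.card_lt_card (Finset.filter_ssubset.2 ⟨i, hi, lt_irrefl _⟩)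

/-- The set of utilities that generate the ranking `R`. -/
def rankingEvent (R : Ranking m) : Set (Fin m → ℝ) := {u | ∀ i j, R i < R j → u j < u i}

lemma measurableSet_rankingEvent (R : Ranking m) : MeasurableSet (rankingEvent R) := by
  have : rankingEvent R = ⋂ i, ⋂ j, {u | R i < R j → u j < u i} := by
    ext; simp [rankingEvent]
  rw [this]
  refine MeasurableSet.iInter fun i => MeasurableSet.iInter fun j => ?_
  by_cases h : R i < R j
  · simpa [h] using measurableSet_lt (measurable_pi_apply j) (measurable_pi_apply i)
  · simp [h]

/-- Without ties, counting the better alternatives is injective and order-reversing, hence a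
permutation. Any other ranking generating `u` has the same counts, because it maps the alternatives
above `i` onto the positions above that of `i`. -/
lemma exists_ranking {u : Fin m → ℝ} (hu : Function.Injective u) :
    ∃ R : Ranking m, (∀ R', u ∈ rankingEvent R' ↔ R' = R) ∧
      (∀ i, (R i : ℕ) = posIn Finset.univ u i) ∧ ∀ i j, R i < R j ↔ u j < u i := by
  let p : Fin m → Fin m := fun i =>
    ⟨posIn Finset.univ u i, by simpa using posIn_lt_card (u := u) (Finset.mem_univ i)⟩
  have hlt : ∀ i j, u j < u i → p i < p j := fun i j h =>
    posIn_lt_posIn (Finset.mem_univ i) h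
  have hlt' : ∀ i j, p i < p j ↔ u j < u i := by
    intro i j
    refine ⟨fun h => ?_, hlt i j⟩
    rcases lt_trichotomy (u i) (u j) with h' | h' | h'
    · exact absurd h (hlt j i h').le.not_gt
    · rw [hu h'] at h
      exact absurd h (lt_irrefl _)
    · exact h'
  have hinj : Function.Injective p := by
    intro i j hij
    by_contra hne
    rcases lt_or_gt_of_ne (hu.ne hne) with h | h
    · exact (hlt j i h).ne hij.symm
    · exact (hlt i j h).ne hij
  refine ⟨Equiv.ofBijective p (Finite.injective_iff_bijective.1 hinj), fun R' => ?_,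
    fun i => rfl, hlt'⟩
  constructor
  · intro h
    have hiff : ∀ i j, R' i < R' j ↔ u j < u i := by
      intro i j
      refine ⟨h i j, fun h' => ?_⟩
      rcases lt_trichotomy (R' i) (R' j) with h1 | h1 | h1
      · exact h1
      · rw [R'.injective h1] at h'
        exact absurd h' (lt_irrefl _)
      · exact absurd (h j i h1) h'.not_gt
    ext i
    change (R' i : ℕ) = posIn Finset.univ u i
    have : posIn Finset.univ u i = (Finset.univ.filter fun i' => R' i' < R' i).card := by
      simp only [posIn, hiff]
    rw [this, ← Finset.card_map R'.toEmbedding]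
    have h2 : (Finset.univ.filter fun i' => R' i' < R' i).map R'.toEmbedding
        = Finset.Iio (R' i) := by
      ext x
      simp only [Finset.mem_map_equiv, Finset.mem_filter, Finset.mem_univ, true_and,
        Equiv.apply_symm_apply, Finset.mem_Iio]
    rw [h2, Fin.card_Iio]
  · rintro rfl i j
    exact (hlt' i j).1

/-- The weights of a breaking as a function of natural numbers. -/
noncomputable def Breaking.extWeight (G : Breaking m) (a b : ℕ) : ℝ :=
  -- Natural-number positions can be offset and reversed freely. The default `0` keeps the weights
  -- bounded and is never reached by actual positions.
  if h : a < m ∧ b < m then G.weight ⟨a, h.1⟩ ⟨b, h.2⟩ else 0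

lemma Breaking.extWeight_of_lt (G : Breaking m) {a b : ℕ} (ha : a < m) (hb : b < m) :
    G.extWeight a b = G.weight ⟨a, ha⟩ ⟨b, hb⟩ := by
  simp [Breaking.extWeight, ha, hb]

lemma Breaking.extWeight_comm (G : Breaking m) (a b : ℕ) : G.extWeight a b = G.extWeight b a := by
  simp only [Breaking.extWeight, and_comm (a := a < m)]
  split_ifs
  · exact G.symm _ _
  · rfl

lemma Breaking.exists_abs_extWeight_le (G : Breaking m) : ∃ C, ∀ a b, |G.extWeight a b| ≤ C := by
  refine ⟨∑ k, ∑ l, |G.weight k l|, fun a b => ?_⟩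
  have h0 : ∀ k, 0 ≤ ∑ l, |G.weight k l| := fun k => Finset.sum_nonneg fun l _ => abs_nonneg _
  rw [Breaking.extWeight]
  split_ifs with h
  · exact (Finset.single_le_sum (f := fun l => |G.weight ⟨a, h.1⟩ l|) (fun l _ => abs_nonneg _)
      (Finset.mem_univ (⟨b, h.2⟩ : Fin m))).trans
      (Finset.single_le_sum (f := fun k => ∑ l, |G.weight k l|) (fun k _ => h0 k)
        (Finset.mem_univ (⟨a, h.1⟩ : Fin m)))
  · simpa using Finset.sum_nonneg fun k _ => h0 k

lemma rankingProb_nonneg (θ : Fin m → ℝ) (R : Ranking m) : 0 ≤ rankingProb π θ R :=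
  measureReal_nonneg

lemma rankingProb_eq (hπ : ∀ i, IsUtilityShape (π i)) (θ : Fin m → ℝ) (R : Ranking m) :
    rankingProb π θ R = (Measure.pi (noiseLaw π)).real {ξ | ξ + θ ∈ rankingEvent R} :=
  utilityLaw_real hπ θ (measurableSet_rankingEvent R)

lemma sum_rankingProb_mul (hπ : ∀ i, IsUtilityShape (π i)) (θ : Fin m → ℝ) (c : Ranking m → ℝ) :
    ∑ R, rankingProb π θ R * c R = ∫ ξ, ∑ R, {ξ | ξ + θ ∈ rankingEvent R}.indicator
      (fun _ => c R) ξ ∂Measure.pi (noiseLaw π) := by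
  have : ∀ i, IsProbabilityMeasure (noiseLaw π i) := fun i => (hπ i).isProbabilityMeasure
  have hm : ∀ R, MeasurableSet {ξ : Fin m → ℝ | ξ + θ ∈ rankingEvent R} := fun R =>
    (measurable_add_const θ) (measurableSet_rankingEvent R)
  rw [integral_finsetSum _ fun R _ => (integrable_const _).indicator (hm R)]
  refine Finset.sum_congr rfl fun R _ => ?_
  rw [integral_indicator_const _ (hm R), rankingProb_eq hπ, smul_eq_mul]

lemma sum_rankingProb (hπ : ∀ i, IsUtilityShape (π i)) (θ : Fin m → ℝ) :
    ∑ R, rankingProb π θ R = 1 := by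
  have : ∀ i, IsProbabilityMeasure (noiseLaw π i) := fun i => (hπ i).isProbabilityMeasure
  have : ∀ i, NullSingletonClass (noiseLaw π i) := fun i => nullSingletonClass_shapeLaw _
  have h := sum_rankingProb_mul hπ θ fun _ => 1
  simp only [mul_one] at h
  rw [h, integral_congr_ae (g := fun _ => 1)]
  · simp
  · filter_upwards [ae_noise_injective θ] with ξ hξ
    obtain ⟨R, hR, -⟩ := exists_ranking hξ
    simp [Set.indicator, hR]

/-- The expected weight of the comparison "`i` above `j`" in a random ranking. -/
lemma sum_rankingProb_mul_comparison (hπ : ∀ i, IsUtilityShape (π i)) (G : Breaking m)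
    (θ : Fin m → ℝ) (i j : Fin m) :
    ∑ R, rankingProb π θ R * G.comparison R i j
      = expComparison (noiseLaw π) Finset.univ G.extWeight θ i j := by
  have : ∀ i, IsProbabilityMeasure (noiseLaw π i) := fun i => (hπ i).isProbabilityMeasure
  have : ∀ i, NullSingletonClass (noiseLaw π i) := fun i => nullSingletonClass_shapeLaw _
  rw [sum_rankingProb_mul hπ, expComparison]
  refine integral_congr_ae ?_
  filter_upwards [ae_noise_injective θ] with ξ hξ
  obtain ⟨R, hR, hpos, hlt⟩ := exists_ranking hξ
  simp only [Set.indicator, Set.mem_ofPred_eq, hR, Finset.sum_ite_eq', Finset.mem_univ, if_true,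
    Breaking.comparison, utilComparison, hlt, ← hpos]
  rw [G.extWeight_of_lt (R i).isLt (R j).isLt]

end RandomRanking

/-! ### Consistency in terms of the limit likelihood -/

section CompositeLikelihood

variable {m : ℕ} {ν : Fin m → Measure ℝ}

/-- The composite log-marginal likelihood with unit weights, as a function of the average weights
`κ` of the comparisons. -/
noncomputable def logLik (ν : Fin m → Measure ℝ) (κ : Fin m × Fin m → ℝ) (θ : Fin m → ℝ) : ℝ :=
  ∑ i, ∑ j, if i ≠ j then κ (i, j) * Real.log (noisePairProb ν θ i j) else 0

/-- The maximizers of `logLik`. -/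
def maximizers (ν : Fin m → Measure ℝ) (κ : Fin m × Fin m → ℝ) : Set (Fin m → ℝ) :=
  {θ | θ ∈ paramSpace m ∧ IsMaxOn (logLik ν κ) (paramSpace m) θ}

/-- The expected weights of the comparisons at the ground truth `θ`. -/
noncomputable def limitWeights (ν : Fin m → Measure ℝ) (G : Breaking m) (θ : Fin m → ℝ) :
    Fin m × Fin m → ℝ :=
  fun ij => expComparison ν Finset.univ G.extWeight θ ij.1 ij.2

lemma logLik_congr (κ : Fin m × Fin m → ℝ) {θ θ' : Fin m → ℝ}
    (h : ∀ i j, θ i - θ j = θ' i - θ' j) : logLik ν κ θ = logLik ν κ θ' := by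
  simp only [logLik, noisePairProb_congr (h _ _)]

lemma isClosed_paramSpace (m : ℕ) : IsClosed (paramSpace m) := by
  simp only [paramSpace, Set.ofPred_forall]
  refine isClosed_iInter fun i => isClosed_iInter fun _ => ?_
  exact isClosed_eq (by fun_prop) (by fun_prop)

lemma continuous_logLik [∀ i, IsProbabilityMeasure (ν i)] [∀ i, NullSingletonClass (ν i)]
    [∀ i, (ν i).IsOpenPosMeasure] :
    Continuous fun p : (Fin m × Fin m → ℝ) × (Fin m → ℝ) => logLik ν p.1 p.2 := by
  refine continuous_finsetSum _ fun i _ => continuous_finsetSum _ fun j _ => ?_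
  by_cases hij : i = j
  · simpa [hij] using continuous_const
  · simp only [ne_eq, hij, not_false_eq_true, if_true]
    exact (by fun_prop : Continuous fun p : (Fin m × Fin m → ℝ) × (Fin m → ℝ) => p.1 (i, j)).mul
      (((continuous_noisePairProb hij).comp continuous_snd).log
        fun p => (noisePairProb_pos p.2 hij).ne')

variable {π : Fin m → ℝ → ℝ}

lemma cll_eq (hπ : ∀ i, IsUtilityShape (π i)) (G : Breaking m) {W : CMLWeights m} {c : ℝ}
    (hW : ∀ i j, i ≠ j → W.weight i j = c) {n : ℕ} (P : Profile m n) (θ : Fin m → ℝ) :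
    cll G W π P θ = c * logLik (noiseLaw π) (fun ij => G.kappa P ij.1 ij.2) θ := by
  simp only [cll, logLik, Finset.mul_sum]
  refine Finset.sum_congr rfl fun i _ => Finset.sum_congr rfl fun j _ => ?_
  by_cases hij : i = j
  · simp [hij]
  · simp only [ne_eq, hij, not_false_eq_true, if_true, hW i j hij, pairProb_eq hπ]
    ring

lemma estimator_eq (hπ : ∀ i, IsUtilityShape (π i)) (G : Breaking m) {W : CMLWeights m}
    (hW : W.IsUniform) {n : ℕ} (P : Profile m n) :
    estimator G W π P = maximizers (noiseLaw π) fun ij => G.kappa P ij.1 ij.2 := by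
  obtain ⟨c, hc, hW⟩ := hW
  ext θ
  simp only [estimator, maximizers, Set.mem_ofPred_eq, isMaxOn_iff, cll_eq hπ G hW,
    mul_le_mul_iff_right₀ hc]

lemma profileProb_nonneg {n : ℕ} (θ : Fin m → ℝ) (P : Profile m n) : 0 ≤ profileProb π θ P :=
  Finset.prod_nonneg fun _ _ => rankingProb_nonneg _ _

lemma profileEventProb_mono {n : ℕ} (θ : Fin m → ℝ) {E F : Set (Profile m n)} (h : E ⊆ F) :
    profileEventProb π θ E ≤ profileEventProb π θ F :=
  Finset.sum_le_sum fun _ _ => Set.indicator_le_indicator_of_subset h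
    (fun _ => profileProb_nonneg _ _) _

lemma profileEventProb_univ (hπ : ∀ i, IsUtilityShape (π i)) {n : ℕ} (θ : Fin m → ℝ) :
    profileEventProb π θ (Set.univ : Set (Profile m n)) = 1 := by
  simp only [profileEventProb, Set.indicator_univ, profileProb]
  have h := Finset.prod_univ_sum (fun _ : Fin n => Finset.univ) (fun _ R => rankingProb π θ R)
  rw [Fintype.piFinset_univ] at h
  simp [← h, sum_rankingProb hπ]

/-- Two events whose probabilities both tend to `1` must eventually intersect; this is how it is
used. -/
lemma profileEventProb_inter (hπ : ∀ i, IsUtilityShape (π i)) {n : ℕ} (θ : Fin m → ℝ)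
    (E F : Set (Profile m n)) : profileEventProb π θ E + profileEventProb π θ F
      ≤ 1 + profileEventProb π θ (E ∩ F) := by
  rw [← profileEventProb_univ hπ θ (n := n)]
  simp only [profileEventProb, ← Finset.sum_add_distrib]
  refine Finset.sum_le_sum fun P _ => ?_
  have := profileProb_nonneg (π := π) θ P
  by_cases hE : P ∈ E <;> by_cases hF : P ∈ F <;> simp [hE, hF, this]

/-- The average weights converge in probability. -/
lemma tendsto_profileEventProb_kappa (hπ : ∀ i, IsUtilityShape (π i)) (G : Breaking m)
    (θ : Fin m → ℝ) {V : Set (Fin m × Fin m → ℝ)} (hV : V ∈ 𝓝 (limitWeights (noiseLaw π) G θ)) :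
    Tendsto (fun n : ℕ => profileEventProb π θ
      {P : Profile m n | (fun ij : Fin m × Fin m => G.kappa P ij.1 ij.2) ∈ V}) atTop (𝓝 1) := by
  let _ : MeasurableSpace (Ranking m) := ⊤
  have : DiscreteMeasurableSpace (Ranking m) := ⟨fun _ => trivial⟩
  refine tendsto_sum_indicator_mean_mem (α := Ranking m) (q := rankingProb π θ)
    (rankingProb_nonneg θ) (sum_rankingProb hπ θ)
    (fun R (ij : Fin m × Fin m) => G.comparison R ij.1 ij.2) ?_
  convert hV using 2
  ext ij
  exact sum_rankingProb_mul_comparison hπ G θ ij.1 ij.2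

/-- The estimator sees the profile only through `κ`, so consistency follows from a deterministic
stability property of the maximizers near the limit weights. -/
lemma isConsistent_of_eventually (hπ : ∀ i, IsUtilityShape (π i)) (G : Breaking m)
    {W : CMLWeights m} (hW : W.IsUniform)
    (h : ∀ θ₀ ∈ paramSpace m, ∀ ε > 0, ∀ᶠ κ in 𝓝 (limitWeights (noiseLaw π) G θ₀),
      (maximizers (noiseLaw π) κ).Nonempty ∧ ∀ θ ∈ maximizers (noiseLaw π) κ, dist θ θ₀ < ε) :
    IsConsistent G W π := by
  intro θ₀ hθ₀ ε hε
  refine tendsto_of_tendsto_of_tendsto_of_le_of_le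
    (tendsto_profileEventProb_kappa hπ G θ₀ (h θ₀ hθ₀ ε hε)) tendsto_const_nhds
    (fun n => profileEventProb_mono θ₀ fun P hP => ?_) (fun n => ?_)
  · simp only [Set.mem_ofPred_eq, estimator_eq hπ G hW]
    exact hP
  · exact (profileEventProb_mono θ₀ (Set.subset_univ _)).trans (profileEventProb_univ hπ θ₀).le

lemma IsConsistent.exists_weights (hπ : ∀ i, IsUtilityShape (π i)) {G : Breaking m}
    {W : CMLWeights m} (hW : W.IsUniform) (h : IsConsistent G W π) {θ₀ : Fin m → ℝ}
    (hθ₀ : θ₀ ∈ paramSpace m) {ε : ℝ} (hε : 0 < ε) {V : Set (Fin m × Fin m → ℝ)}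
    (hV : V ∈ 𝓝 (limitWeights (noiseLaw π) G θ₀)) :
    ∃ κ ∈ V, ∃ θ ∈ maximizers (noiseLaw π) κ, dist θ θ₀ < ε := by
  by_contra hno
  have h2 := (h θ₀ hθ₀ ε hε).add (tendsto_profileEventProb_kappa hπ G θ₀ hV)
  have h3 : (1 : ℝ) + 1 ≤ 1 := by
    refine le_of_tendsto h2 (Eventually.of_forall fun n => ?_)
    refine (profileEventProb_inter hπ θ₀ _ _).trans ?_
    rw [Set.eq_empty_of_forall_notMem (s := _ ∩ _)]
    · simp [profileEventProb]
    · rintro P ⟨⟨⟨θ, hθ⟩, hP⟩, hPV⟩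
      exact hno ⟨_, hPV, θ, estimator_eq hπ G hW P ▸ hθ, hP θ hθ⟩
  norm_num at h3

/-- If the estimator is consistent, then the ground truth maximizes the limit of the composite
log-marginal likelihood. -/
lemma IsConsistent.logLik_le (hπ : ∀ i, IsUtilityShape (π i)) {G : Breaking m}
    {W : CMLWeights m} (hW : W.IsUniform) (h : IsConsistent G W π) {θ₀ θ : Fin m → ℝ}
    (hθ₀ : θ₀ ∈ paramSpace m) (hθ : θ ∈ paramSpace m) :
    logLik (noiseLaw π) (limitWeights (noiseLaw π) G θ₀) θ
      ≤ logLik (noiseLaw π) (limitWeights (noiseLaw π) G θ₀) θ₀ := by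
  have : ∀ i, IsProbabilityMeasure (noiseLaw π i) := fun i => (hπ i).isProbabilityMeasure
  have : ∀ i, NullSingletonClass (noiseLaw π i) := fun i => nullSingletonClass_shapeLaw _
  have : ∀ i, (noiseLaw π i).IsOpenPosMeasure := fun i => (hπ i).isOpenPosMeasure
  by_contra! hlt
  have hc := continuous_logLik (ν := noiseLaw π)
  -- If `θ` were strictly better than `θ₀`, it would remain strictly better than every point near
  -- `θ₀` for all weights near the limit; yet consistency supplies such weights with a maximizer
  -- near `θ₀`.
  have hop : IsOpen {p : (Fin m × Fin m → ℝ) × (Fin m → ℝ) |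
      logLik (noiseLaw π) p.1 p.2 < logLik (noiseLaw π) p.1 θ} :=
    isOpen_lt hc (hc.comp (continuous_fst.prodMk continuous_const))
  have hev := hop.mem_nhds (x := (limitWeights (noiseLaw π) G θ₀, θ₀)) hlt
  rw [nhds_prod_eq] at hev
  obtain ⟨V, hV, U, hU, hsub⟩ := Filter.mem_prod_iff.1 hev
  obtain ⟨ε, hε, hball⟩ := Metric.mem_nhds_iff.1 hU
  obtain ⟨κ, hκ, θ₁, hθ₁, hd⟩ := h.exists_weights hπ hW hθ₀ hε hV
  have h1 : logLik (noiseLaw π) κ θ₁ < logLik (noiseLaw π) κ θ :=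
    hsub (Set.mk_mem_prod hκ (hball hd))
  exact h1.not_ge (hθ₁.2 hθ)

end CompositeLikelihood

/-! ### Gibbs' inequality and stability of the maximizers -/

section Uniform

variable {m : ℕ} {ν : Fin m → Measure ℝ}

/-- This is `log x ≤ x - 1` at `x = b / a`. The linear error `b - a` is kept because it cancels when
summed over ordered pairs. -/
lemma mul_log_le {a b : ℝ} (ha : 0 < a) (hb : 0 < b) :
    a * Real.log b ≤ a * Real.log a + (b - a) := by
  have h := Real.log_le_sub_one_of_pos (div_pos hb ha)
  rw [Real.log_div hb.ne' ha.ne'] at h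
  have h2 := mul_le_mul_of_nonneg_left h ha.le
  have h3 : a * (b / a - 1) = b - a := by field_simp
  linarith

lemma mul_log_lt {a b : ℝ} (ha : 0 < a) (hb : 0 < b) (hab : a ≠ b) :
    a * Real.log b < a * Real.log a + (b - a) := by
  have h := Real.log_lt_sub_one_of_pos (div_pos hb ha) (by
    rw [ne_eq, div_eq_one_iff_eq ha.ne']; exact hab.symm)
  rw [Real.log_div hb.ne' ha.ne'] at h
  have h2 := mul_lt_mul_of_pos_left h ha
  have h3 : a * (b / a - 1) = b - a := by field_simp
  linarith

variable [∀ i, IsProbabilityMeasure (ν i)]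

lemma term_nonpos {κ : Fin m × Fin m → ℝ} (hκ : ∀ i j, i ≠ j → 0 ≤ κ (i, j)) (θ : Fin m → ℝ)
    (i j : Fin m) :
    (if i ≠ j then κ (i, j) * Real.log (noisePairProb ν θ i j) else 0) ≤ 0 := by
  split_ifs with hij
  · exact mul_nonpos_of_nonneg_of_nonpos (hκ i j hij)
      (Real.log_nonpos (noisePairProb_nonneg θ i j) (noisePairProb_le_one θ i j))
  · exact le_rfl

/-- All terms are nonpositive, so a single very negative one rules out a parameter; this is the
source of coercivity. -/
lemma logLik_le_term {κ : Fin m × Fin m → ℝ} (hκ : ∀ i j, i ≠ j → 0 ≤ κ (i, j)) (θ : Fin m → ℝ)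
    {i j : Fin m} (hij : i ≠ j) :
    logLik ν κ θ ≤ κ (i, j) * Real.log (noisePairProb ν θ i j) := by
  have h1 : ∀ i j, 0 ≤ -(if i ≠ j then κ (i, j) * Real.log (noisePairProb ν θ i j) else 0) :=
    fun i j => neg_nonneg.2 (term_nonpos hκ θ i j)
  have h2 := (Finset.single_le_sum (fun j _ => h1 i j) (Finset.mem_univ j)).trans
    (Finset.single_le_sum (fun i _ => Finset.sum_nonneg fun j _ => h1 i j) (Finset.mem_univ i))
  simp only [Finset.sum_neg_distrib, neg_le_neg_iff] at h2
  simpa [logLik, hij] using h2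

variable [∀ i, NullSingletonClass (ν i)]

lemma sum_noisePairProb_sub (θ θ' : Fin m → ℝ) :
    ∑ i, ∑ j, (if i ≠ j then noisePairProb ν θ i j - noisePairProb ν θ' i j else 0) = 0 := by
  have h : ∑ i, ∑ j, (if i ≠ j then noisePairProb ν θ i j - noisePairProb ν θ' i j else 0)
      + ∑ i, ∑ j, (if i ≠ j then noisePairProb ν θ i j - noisePairProb ν θ' i j else 0) = 0 := by
    -- Adding the transposed sum pairs `(i, j)` with `(j, i)`, whose probabilities sum to `1` at
    -- both parameters.
    nth_rw 2 [Finset.sum_comm]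
    simp only [← Finset.sum_add_distrib]
    refine Finset.sum_eq_zero fun i _ => Finset.sum_eq_zero fun j _ => ?_
    by_cases hij : i = j
    · simp [hij]
    · have h1 := noisePairProb_add_swap (ν := ν) θ hij
      have h2 := noisePairProb_add_swap (ν := ν) θ' hij
      simp only [ne_eq, hij, Ne.symm hij, not_false_eq_true, if_true]
      linarith
  linarith

variable [∀ i, (ν i).IsOpenPosMeasure]

/-- Gibbs' inequality: the ground truth is the unique maximizer if the weights are proportional to
the pairwise probabilities. -/
lemma logLik_lt_of_ne {κ : Fin m × Fin m → ℝ} {θ₀ θ : Fin m → ℝ} {c : ℝ} (hc : 0 < c)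
    (hκ : ∀ i j, i ≠ j → κ (i, j) = c * noisePairProb ν θ₀ i j) (hθ₀ : θ₀ ∈ paramSpace m)
    (hθ : θ ∈ paramSpace m) (hne : θ ≠ θ₀) : logLik ν κ θ < logLik ν κ θ₀ := by
  have hterm : ∀ i j, (if i ≠ j then κ (i, j) * Real.log (noisePairProb ν θ i j) else 0)
      ≤ (if i ≠ j then κ (i, j) * Real.log (noisePairProb ν θ₀ i j) else 0)
        + c * (if i ≠ j then noisePairProb ν θ i j - noisePairProb ν θ₀ i j else 0) := by
    intro i j
    by_cases hij : i = j
    · simp [hij]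
    · simp only [ne_eq, hij, not_false_eq_true, if_true, hκ i j hij, mul_assoc, ← mul_add]
      exact mul_le_mul_of_nonneg_left
        (mul_log_le (noisePairProb_pos θ₀ hij) (noisePairProb_pos θ hij)) hc.le
  obtain ⟨i, hi⟩ := Function.ne_iff.1 hne
  have hm : 0 < m := i.pos
  -- The last alternative is pinned at `0` in both parameters, so a coordinate in which they differ
  -- changes its difference with `l`.
  let l : Fin m := ⟨m - 1, by omega⟩
  have hl : (l : ℕ) + 1 = m := Nat.sub_add_cancel hm
  have hil : i ≠ l := by
    rintro rfl
    exact hi ((hθ _ hl).trans (hθ₀ _ hl).symm)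
  have hp : noisePairProb ν θ₀ i l ≠ noisePairProb ν θ i l := by
    have h0 := hθ _ hl
    have h1 := hθ₀ _ hl
    rcases lt_or_gt_of_ne hi with h | h
    · exact (noisePairProb_strictMono hil (by linarith)).ne'
    · exact (noisePairProb_strictMono hil (by linarith)).ne
  have hstrict : ∃ i ∈ Finset.univ, (∑ j, if i ≠ j then κ (i, j) *
      Real.log (noisePairProb ν θ i j) else 0)
      < ∑ j, ((if i ≠ j then κ (i, j) * Real.log (noisePairProb ν θ₀ i j) else 0)
        + c * (if i ≠ j then noisePairProb ν θ i j - noisePairProb ν θ₀ i j else 0)) := by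
    refine ⟨i, Finset.mem_univ _, Finset.sum_lt_sum (fun j _ => hterm i j)
      ⟨l, Finset.mem_univ _, ?_⟩⟩
    simp only [ne_eq, hil, not_false_eq_true, if_true, hκ i l hil, mul_assoc, ← mul_add]
    exact mul_lt_mul_of_pos_left
        (mul_log_lt (noisePairProb_pos θ₀ hil) (noisePairProb_pos θ hil) hp) hc
  have h := Finset.sum_lt_sum (fun i _ => Finset.sum_le_sum fun j _ => hterm i j) hstrict
  simp only [Finset.sum_add_distrib, ← Finset.mul_sum, sum_noisePairProb_sub, mul_zero,
    add_zero] at h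
  exact h

/-- Maximizers exist and are close to the ground truth `θ₀` if the weights are close to multiples
of the pairwise probabilities at `θ₀`. -/
lemma eventually_maximizers {κ₀ : Fin m × Fin m → ℝ} {θ₀ : Fin m → ℝ} {c : ℝ} (hc : 0 < c)
    (hκ₀ : ∀ i j, i ≠ j → κ₀ (i, j) = c * noisePairProb ν θ₀ i j) (hθ₀ : θ₀ ∈ paramSpace m)
    {ε : ℝ} (hε : 0 < ε) :
    ∀ᶠ κ in 𝓝 κ₀, (maximizers ν κ).Nonempty ∧ ∀ θ ∈ maximizers ν κ, dist θ θ₀ < ε := by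
  have hcont := continuous_logLik (ν := ν)
  have hpos : ∀ i j, i ≠ j → 0 < κ₀ (i, j) := fun i j hij => by
    rw [hκ₀ i j hij]
    exact mul_pos hc (noisePairProb_pos θ₀ hij)
  -- The level `-M` lies one below the limit likelihood at `θ₀`, so nearby weights keep `θ₀` above
  -- it.
  set M : ℝ := 1 - logLik ν κ₀ θ₀ with hM
  -- Beyond `B i j`, the `(i, j)` term alone is below `-M`, even with half of its limiting weight.
  have hB : ∀ i j, ∃ B : ℝ, i ≠ j → ∀ θ : Fin m → ℝ, θ i - θ j ≤ -B →
      noisePairProb ν θ i j < Real.exp (-(M / (κ₀ (i, j) / 2))) := fun i j => by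
    obtain ⟨B, hB⟩ := exists_noisePairProb_lt (ν := ν) (i := i) (j := j)
      (Real.exp_pos (-(M / (κ₀ (i, j) / 2))))
    exact ⟨B, fun _ => hB⟩
  choose B hB using hB
  -- Comparison with the pinned last coordinate bounds each `θ i`; the sums over `j` dominate the
  -- one bound that is needed.
  set K : Set (Fin m → ℝ) := paramSpace m ∩ Set.pi Set.univ fun i =>
    Set.Icc (-∑ j, |B i j|) (∑ j, |B j i|) with hK
  have hKc : IsCompact K :=
    (isCompact_univ_pi fun _ => isCompact_Icc).inter_left (isClosed_paramSpace m)
  have hhalf : ∀ᶠ κ in 𝓝 κ₀, ∀ i j, i ≠ j → κ₀ (i, j) / 2 < κ (i, j) := by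
    simp only [eventually_all]
    intro i j hij
    exact (continuous_apply (i, j)).continuousAt.eventually
      (lt_mem_nhds (half_lt_self (hpos i j hij)))
  have hlow : ∀ᶠ κ in 𝓝 κ₀, -M < logLik ν κ θ₀ := by
    have : Continuous fun κ => logLik ν κ θ₀ := hcont.comp (continuous_id.prodMk continuous_const)
    exact this.continuousAt.eventually (lt_mem_nhds (by rw [hM]; linarith))
  have hfar : ∀ᶠ κ in 𝓝 κ₀, ∀ θ ∈ K \ Metric.ball θ₀ ε, logLik ν κ θ < logLik ν κ θ₀ := by
    refine (hKc.diff Metric.isOpen_ball).eventually_forall_of_forall_eventually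
      (P := fun κ θ => logLik ν κ θ < logLik ν κ θ₀) fun θ hθ => ?_
    have hop : IsOpen {p : (Fin m × Fin m → ℝ) × (Fin m → ℝ) |
        logLik ν p.1 p.2 < logLik ν p.1 θ₀} :=
      isOpen_lt hcont (hcont.comp (continuous_fst.prodMk continuous_const))
    refine hop.mem_nhds (x := (κ₀, θ)) (logLik_lt_of_ne hc hκ₀ hθ₀ hθ.1.1 ?_)
    rintro rfl
    exact hθ.2 (Metric.mem_ball_self hε)
  filter_upwards [hhalf, hlow, hfar] with κ h1 h2 h3
  have hκ : ∀ i j, i ≠ j → 0 ≤ κ (i, j) := fun i j hij =>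
    ((half_pos (hpos i j hij)).trans (h1 i j hij)).le
  have hout : ∀ θ ∈ paramSpace m, logLik ν κ θ₀ ≤ logLik ν κ θ → θ ∈ K := by
    intro θ hθ hle
    have hdiff : ∀ i j, i ≠ j → -B i j < θ i - θ j := by
      intro i j hij
      by_contra! hcon
      have hp := hB i j hij θ hcon
      have hl : Real.log (noisePairProb ν θ i j) < -(M / (κ₀ (i, j) / 2)) :=
        (Real.log_lt_iff_lt_exp (noisePairProb_pos θ hij)).2 hp
      have hl0 : Real.log (noisePairProb ν θ i j) ≤ 0 :=
        Real.log_nonpos (noisePairProb_nonneg θ i j) (noisePairProb_le_one θ i j)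
      have h4 := logLik_le_term (ν := ν) hκ θ hij
      have h5 : κ (i, j) * Real.log (noisePairProb ν θ i j)
          ≤ κ₀ (i, j) / 2 * Real.log (noisePairProb ν θ i j) :=
        mul_le_mul_of_nonpos_right (h1 i j hij).le hl0
      have h6 : κ₀ (i, j) / 2 * Real.log (noisePairProb ν θ i j) < -M := by
        calc _ < κ₀ (i, j) / 2 * -(M / (κ₀ (i, j) / 2)) :=
              mul_lt_mul_of_pos_left hl (half_pos (hpos i j hij))
          _ = -M := by have := (hpos i j hij).ne'; field_simp
      linarith
    refine ⟨hθ, fun i _ => ?_⟩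
    have hs1 : 0 ≤ ∑ j, |B i j| := Finset.sum_nonneg fun _ _ => abs_nonneg _
    have hs2 : 0 ≤ ∑ j, |B j i| := Finset.sum_nonneg fun _ _ => abs_nonneg _
    by_cases hil : (i : ℕ) + 1 = m
    · rw [hθ i hil]
      exact ⟨by linarith, hs2⟩
    · let l : Fin m := ⟨m - 1, by have := i.pos; omega⟩
      have hl : (l : ℕ) + 1 = m := Nat.sub_add_cancel i.pos
      have hne : i ≠ l := by
        intro h
        exact hil (h ▸ hl)
      have hl0 := hθ l hl
      have e1 := hdiff i l hne
      have e2 := hdiff l i hne.symm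
      have e3 := Finset.single_le_sum (f := fun j => |B i j|) (fun _ _ => abs_nonneg _)
        (Finset.mem_univ l)
      have e4 := Finset.single_le_sum (f := fun j => |B j i|) (fun _ _ => abs_nonneg _)
        (Finset.mem_univ l)
      have e5 := le_abs_self (B i l)
      have e6 := le_abs_self (B l i)
      exact ⟨by linarith, by linarith⟩
  have hclose : ∀ θ ∈ paramSpace m, logLik ν κ θ₀ ≤ logLik ν κ θ → dist θ θ₀ < ε := by
    intro θ hθ hle
    by_contra hd
    exact (h3 θ ⟨hout θ hθ hle, hd⟩).not_ge hle
  refine ⟨?_, fun θ hθ => hclose θ hθ.1 (hθ.2 hθ₀)⟩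
  have hcκ : Continuous (logLik ν κ) := hcont.comp (continuous_const.prodMk continuous_id)
  obtain ⟨θ₁, hθ₁, hmax⟩ := hKc.exists_isMaxOn ⟨θ₀, hout θ₀ hθ₀ le_rfl⟩ hcκ.continuousOn
  refine ⟨θ₁, hθ₁.1, fun θ hθ => ?_⟩
  by_cases hle : logLik ν κ θ₀ ≤ logLik ν κ θ
  · exact hmax (hout θ hθ hle)
  · exact (not_le.1 hle).le.trans (hmax (hout θ₀ hθ₀ le_rfl))

end Uniform

/-! ### Uniform breakings are consistent -/

section Sufficiency

variable {m : ℕ} {π : Fin m → ℝ → ℝ}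

lemma isConsistent_of_isUniform (hπ : ∀ i, IsUtilityShape (π i)) {G : Breaking m} (hG : G.HasEdge)
    {W : CMLWeights m} (hW : W.IsUniform) (hu : G.IsUniform) : IsConsistent G W π := by
  have : ∀ i, IsProbabilityMeasure (noiseLaw π i) := fun i => (hπ i).isProbabilityMeasure
  have : ∀ i, NullSingletonClass (noiseLaw π i) := fun i => nullSingletonClass_shapeLaw _
  have : ∀ i, (noiseLaw π i).IsOpenPosMeasure := fun i => (hπ i).isOpenPosMeasure
  obtain ⟨c, hc⟩ := hu
  have hpos : 0 < c := by
    obtain ⟨k, l, hkl, h⟩ := hG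
    rwa [hc k l hkl] at h
  refine isConsistent_of_eventually hπ G hW fun θ₀ hθ₀ ε hε =>
    eventually_maximizers hpos (fun i j hij => ?_) hθ₀ hε
  rw [limitWeights, ← expComparison_const Finset.univ]
  refine integral_congr_ae (ae_of_all _ fun ξ => ?_)
  simp only [utilComparison]
  split_ifs with h
  · have hlt := posIn_lt_posIn (Finset.mem_univ i) h
    have h1 := posIn_lt_card (u := ξ + θ₀) (Finset.mem_univ i)
    have h2 := posIn_lt_card (u := ξ + θ₀) (Finset.mem_univ j)
    rw [Finset.card_univ, Fintype.card_fin] at h1 h2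
    rw [G.extWeight_of_lt h1 h2]
    exact hc _ _ fun h => hlt.ne (Fin.mk.inj h)
  · rfl

end Sufficiency

/-! ### Gaussian densities and tails -/

section Gaussian

variable {v : ℝ≥0}

lemma continuous_gaussianPDFReal (μ : ℝ) (v : ℝ≥0) : Continuous (gaussianPDFReal μ v) := by
  unfold gaussianPDFReal
  fun_prop

lemma gaussianPDFReal_le (μ : ℝ) (v : ℝ≥0) (x : ℝ) :
    gaussianPDFReal μ v x ≤ (√(2 * Real.pi * v))⁻¹ := by
  unfold gaussianPDFReal
  refine mul_le_of_le_one_right (by positivity) (Real.exp_le_one_iff.2 ?_)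
  exact div_nonpos_of_nonpos_of_nonneg (neg_nonpos.2 (sq_nonneg _)) (by positivity)

lemma tendsto_gaussianPDFReal_cocompact (μ : ℝ) (hv : v ≠ 0) :
    Tendsto (gaussianPDFReal μ v) (cocompact ℝ) (𝓝 0) := by
  have hv' : (0 : ℝ) < v := by exact_mod_cast pos_iff_ne_zero.2 hv
  have h1 : Tendsto (fun x : ℝ => |x - μ|) (cocompact ℝ) atTop :=
    tendsto_norm_cocompact_atTop.comp (Homeomorph.subRight μ).isClosedEmbedding.tendsto_cocompact
  have h2 : Tendsto (fun x : ℝ => (x - μ) ^ 2 / (2 * v)) (cocompact ℝ) atTop := by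
    have := ((tendsto_pow_atTop two_ne_zero).comp h1).atTop_div_const
      (show (0 : ℝ) < 2 * v by positivity)
    simpa [Function.comp_def] using this
  have h3 := (Real.tendsto_exp_neg_atTop_nhds_zero.comp h2).const_mul (√(2 * Real.pi * v))⁻¹
  rw [mul_zero] at h3
  refine h3.congr fun x => ?_
  simp [gaussianPDFReal, neg_div]

lemma gaussianReal_real_eq (hv : v ≠ 0) (s : Set ℝ) :
    (gaussianReal 0 v).real s = ∫ x in s, gaussianPDFReal 0 v x := by
  rw [measureReal_def, gaussianReal_apply_eq_integral _ hv,
    ENNReal.toReal_ofReal (integral_nonneg fun x => gaussianPDFReal_nonneg _ _ _)]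

lemma hasDerivAt_gaussianReal_Ioi (hv : v ≠ 0) (s : ℝ) :
    HasDerivAt (fun s => (gaussianReal 0 v).real (Set.Ioi s)) (-gaussianPDFReal 0 v s) s := by
  have hint := integrable_gaussianPDFReal 0 v
  have h : (fun s => (gaussianReal 0 v).real (Set.Ioi s))
      = fun s => (gaussianReal 0 v).real (Set.Ioi 0) - ∫ x in (0 : ℝ)..s, gaussianPDFReal 0 v x := by
    ext s
    rw [gaussianReal_real_eq hv, gaussianReal_real_eq hv,
      ← intervalIntegral.integral_Ioi_sub_Ioi' hint.integrableOn hint.integrableOn]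
    ring
  rw [h]
  exact (intervalIntegral.integral_hasDerivAt_right (hint.intervalIntegrable)
    (measurable_gaussianPDFReal 0 v).stronglyMeasurable.stronglyMeasurableAtFilter
    (continuous_gaussianPDFReal 0 v).continuousAt).const_sub _

/-- The lower tail of a Gaussian distribution decays faster than exponentially. -/
lemma gaussianReal_Iio_le (hv : v ≠ 0) (x : ℝ) :
    (gaussianReal 0 v).real (Set.Iio x)
      ≤ Real.exp ((2 * x + 1) / (2 * v)) * (gaussianReal 0 v).real (Set.Iio (x + 1)) := by
  have hv' : (0 : ℝ) < v := by exact_mod_cast pos_iff_ne_zero.2 hv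
  have hint := integrable_gaussianPDFReal 0 v
  have hshift : ∫ y in Set.Iio (x + 1), gaussianPDFReal 0 v y
      = ∫ y in Set.Iio x, gaussianPDFReal 0 v (y + 1) := by
    rw [← (measurePreserving_add_right (volume : Measure ℝ) 1).setIntegral_preimage_emb
      (measurableEmbedding_addRight 1)]
    simp
  rw [gaussianReal_real_eq hv, gaussianReal_real_eq hv, hshift, ← integral_const_mul]
  refine setIntegral_mono_on hint.integrableOn ((hint.comp_add_right 1).const_mul _).integrableOn
    measurableSet_Iio fun y hy => ?_
  have hy : y < x := hy
  -- The ratio of the densities at `y` and `y + 1` increases with `y`, so on `Iio x` it is at most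
  -- its value at `x`.
  have : gaussianPDFReal 0 v y
      = Real.exp ((2 * y + 1) / (2 * v)) * gaussianPDFReal 0 v (y + 1) := by
    simp only [gaussianPDFReal]
    rw [mul_left_comm, ← Real.exp_add]
    congr 2
    field_simp
    ring
  rw [this]
  refine mul_le_mul_of_nonneg_right (Real.exp_le_exp.2 ?_) (gaussianPDFReal_nonneg _ _ _)
  gcongr

end Gaussian

/-! ### Differentiation in the Gaussian coordinate -/

section FirstOrder

variable {m : ℕ} {ν : Fin m → Measure ℝ} {v : ℝ≥0} {g : Fin m}

/-- The density at `t` of `Y - X` for independent `Y` with law `μ` and `X` Gaussian with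
variance `v`. -/
noncomputable def diffDensity (v : ℝ≥0) (μ : Measure ℝ) (t : ℝ) : ℝ :=
  ∫ y, gaussianPDFReal 0 v (y - t) ∂μ

lemma integrable_gaussianPDFReal_sub (μ : Measure ℝ) [IsProbabilityMeasure μ] (t : ℝ) :
    Integrable (fun y => gaussianPDFReal 0 v (y - t)) μ := by
  refine Integrable.of_bound (C := (√(2 * Real.pi * v))⁻¹)
    ((measurable_gaussianPDFReal 0 v).comp (by fun_prop)).aestronglyMeasurable
    (ae_of_all _ fun y => ?_)
  rw [Real.norm_of_nonneg (gaussianPDFReal_nonneg _ _ _)]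
  exact gaussianPDFReal_le _ _ _

lemma diffDensity_pos (hv : v ≠ 0) (μ : Measure ℝ) [IsProbabilityMeasure μ] (t : ℝ) :
    0 < diffDensity v μ t := by
  refine (integral_pos_iff_support_of_nonneg (fun y => gaussianPDFReal_nonneg _ _ _)
    (integrable_gaussianPDFReal_sub μ t)).2 ?_
  have : Function.support (fun y => gaussianPDFReal 0 v (y - t)) = Set.univ :=
    Set.eq_univ_of_forall fun y => (gaussianPDFReal_pos _ _ _ hv).ne'
  simp [this]

/-- Dominated convergence, as the Gaussian density is bounded and vanishes at infinity. This makes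
distant alternatives drop out of the first order condition. -/
lemma tendsto_diffDensity_cocompact (hv : v ≠ 0) (μ : Measure ℝ) [IsProbabilityMeasure μ] :
    Tendsto (diffDensity v μ) (cocompact ℝ) (𝓝 0) := by
  have : (cocompact ℝ).IsCountablyGenerated := by
    rw [cocompact_eq_atBot_atTop]
    infer_instance
  have h := tendsto_integral_filter_of_dominated_convergence (μ := μ) (l := cocompact ℝ)
    (F := fun t y => gaussianPDFReal 0 v (y - t)) (f := fun _ => 0)
    (fun _ => (√(2 * Real.pi * v))⁻¹)
    (Eventually.of_forall fun t => (integrable_gaussianPDFReal_sub μ t).aestronglyMeasurable)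
    (Eventually.of_forall fun t => ae_of_all _ fun y => by
      rw [Real.norm_of_nonneg (gaussianPDFReal_nonneg _ _ _)]
      exact gaussianPDFReal_le _ _ _)
    (integrable_const _)
    (ae_of_all _ fun y => (tendsto_gaussianPDFReal_cocompact 0 hv).comp
      (Homeomorph.subLeft y).isClosedEmbedding.tendsto_cocompact)
  rw [integral_zero] at h
  exact h

variable [∀ i, IsProbabilityMeasure (ν i)]

lemma noisePairProb_eq_integral {j : Fin m} (hj : g ≠ j) (θ : Fin m → ℝ) :
    noisePairProb ν θ g j = ∫ y, (ν g).real (Set.Ioi (y - (θ g - θ j))) ∂ν j := by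
  have hs : MeasurableSet {p : ℝ × ℝ | p.1 + θ j < p.2 + θ g} :=
    measurableSet_lt (by fun_prop) (by fun_prop)
  have h : noisePairProb ν θ g j = ((ν j).prod (ν g)).real {p : ℝ × ℝ | p.1 + θ j < p.2 + θ g} := by
    rw [← map_noise_pair hj.symm, map_measureReal_apply (by fun_prop) hs]
    rfl
  have hsec : ∀ y, Prod.mk y ⁻¹' {p : ℝ × ℝ | p.1 + θ j < p.2 + θ g}
      = Set.Ioi (y - (θ g - θ j)) := by
    intro y
    ext x
    simp only [Set.mem_preimage, Set.mem_ofPred_eq, Set.mem_Ioi]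
    constructor <;> intro <;> linarith
  have hmeas := measurable_measure_prodMk_left (ν := ν g) hs
  rw [h, measureReal_def, Measure.prod_apply hs, ← integral_toReal hmeas.aemeasurable
    (ae_of_all _ fun y => measure_lt_top _ _)]
  simp only [hsec, measureReal_def]

/-- Condition on the noise of `j`: only the Gaussian tail is differentiated, and its bounded density
justifies differentiation under the integral for any law of `j`. -/
lemma hasDerivAt_noisePairProb (hv : v ≠ 0) (hg : ν g = gaussianReal 0 v) {j : Fin m}
    (hj : g ≠ j) (θ : Fin m → ℝ) :
    HasDerivAt (fun s : ℝ => noisePairProb ν (Function.update θ g (θ g + s)) g j)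
      (diffDensity v (ν j) (θ g - θ j)) 0 := by
  have h : (fun s : ℝ => noisePairProb ν (Function.update θ g (θ g + s)) g j)
      = fun s => ∫ y, (gaussianReal 0 v).real (Set.Ioi (y - (θ g - θ j) - s)) ∂ν j := by
    ext s
    rw [noisePairProb_eq_integral hj]
    simp only [Function.update_self, Function.update_of_ne hj.symm, hg]
    congr 1 with y
    congr 2
    ring
  have hd : ∀ y s, HasDerivAt (fun s => (gaussianReal 0 v).real (Set.Ioi (y - (θ g - θ j) - s)))
      (gaussianPDFReal 0 v (y - (θ g - θ j) - s)) s := by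
    intro y s
    have := (hasDerivAt_gaussianReal_Ioi hv (y - (θ g - θ j) - s)).comp s
      ((hasDerivAt_id s).const_sub (y - (θ g - θ j)))
    simpa [Function.comp_def] using this
  have hmeas : ∀ s, AEStronglyMeasurable
      (fun y => (gaussianReal 0 v).real (Set.Ioi (y - (θ g - θ j) - s))) (ν j) := by
    intro s
    have hanti : Antitone fun y => (gaussianReal 0 v).real (Set.Ioi (y - (θ g - θ j) - s)) :=
      fun a b hab => measureReal_mono (Set.Ioi_subset_Ioi (by linarith))
    exact hanti.measurable.aestronglyMeasurable
  have key := (hasDerivAt_integral_of_dominated_loc_of_deriv_le (μ := ν j) (x₀ := (0 : ℝ))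
    (s := Set.univ) (bound := fun _ => (√(2 * Real.pi * v))⁻¹)
    (F := fun s y => (gaussianReal 0 v).real (Set.Ioi (y - (θ g - θ j) - s)))
    (F' := fun s y => gaussianPDFReal 0 v (y - (θ g - θ j) - s)) Filter.univ_mem
    (Eventually.of_forall hmeas)
    (Integrable.of_bound (C := 1) (hmeas 0) (ae_of_all _ fun y => by
      rw [Real.norm_of_nonneg measureReal_nonneg]
      exact measureReal_le_one))
    ((measurable_gaussianPDFReal 0 v).comp (by fun_prop)).aestronglyMeasurable
    (ae_of_all _ fun y s _ => by
      rw [Real.norm_of_nonneg (gaussianPDFReal_nonneg _ _ _)]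
      exact gaussianPDFReal_le _ _ _)
    (integrable_const _) (ae_of_all _ fun y s _ => hd y s)).2
  rw [h]
  simpa [diffDensity] using key

variable [∀ i, NullSingletonClass (ν i)] [∀ i, (ν i).IsOpenPosMeasure]

/-- The first order condition for a maximum, in the direction of the Gaussian alternative. -/
lemma first_order_condition (hv : v ≠ 0) (hg : ν g = gaussianReal 0 v) {κ : Fin m × Fin m → ℝ}
    {θ : Fin m → ℝ} (hmax : ∀ θ', logLik ν κ θ' ≤ logLik ν κ θ) :
    ∑ j ∈ Finset.univ.erase g, diffDensity v (ν j) (θ g - θ j) *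
      (κ (g, j) / noisePairProb ν θ g j - κ (j, g) / noisePairProb ν θ j g) = 0 := by
  set φ : ℝ → Fin m → ℝ := fun s => Function.update θ g (θ g + s) with hφ
  have hφ0 : φ 0 = θ := by simp [hφ]
  -- Only pairs containing `g` contribute; when `g` is the second entry the sign flips, since the
  -- two outcomes have total probability `1`.
  let D : Fin m → Fin m → ℝ := fun i j =>
    (if i = g then if j ≠ g then
      κ (g, j) / noisePairProb ν θ g j * diffDensity v (ν j) (θ g - θ j) else 0 else 0)
    - (if j = g then if i ≠ g then
      κ (i, g) / noisePairProb ν θ i g * diffDensity v (ν i) (θ g - θ i) else 0 else 0)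
  have hD : ∀ i j, HasDerivAt (fun s => if i ≠ j then
      κ (i, j) * Real.log (noisePairProb ν (φ s) i j) else 0) (D i j) 0 := by
    intro i j
    by_cases hij : i = j
    · subst hij
      have hDi : D i i = 0 := by
        by_cases hi : i = g <;> simp [D, hi]
      simpa [hDi] using hasDerivAt_const (0 : ℝ) (0 : ℝ)
    simp only [ne_eq, hij, not_false_eq_true, if_true]
    by_cases hi : i = g
    · subst hi
      have h1 := ((hasDerivAt_noisePairProb hv hg hij θ).log
        (noisePairProb_pos _ hij).ne').const_mul (κ (i, j))
      refine h1.congr_deriv ?_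
      have : Function.update θ i (θ i + 0) = θ := by simp
      simp only [D, if_true, Ne.symm hij, ne_eq, not_false_eq_true, if_false, sub_zero, this]
      ring
    by_cases hj : j = g
    · subst hj
      have h0 : (fun s => noisePairProb ν (φ s) i j) = fun s => 1 - noisePairProb ν (φ s) j i := by
        ext s
        have := noisePairProb_add_swap (ν := ν) (φ s) hij
        linarith
      have h1 := (hasDerivAt_noisePairProb hv hg (Ne.symm hij) θ).const_sub 1
      rw [← h0] at h1
      have h2 := (h1.log (noisePairProb_pos _ hij).ne').const_mul (κ (i, j))
      refine h2.congr_deriv ?_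
      simp only [D, if_true, hij, ne_eq, not_false_eq_true, if_false, zero_sub, hφ0]
      ring
    · have hconst : (fun s => κ (i, j) * Real.log (noisePairProb ν (φ s) i j))
          = fun _ => κ (i, j) * Real.log (noisePairProb ν θ i j) := by
        ext s
        rw [noisePairProb_congr (θ' := θ)]
        simp [hφ, Function.update_of_ne hi, Function.update_of_ne hj]
      rw [hconst]
      have hDi : D i j = 0 := by simp [D, hi, hj]
      rw [hDi]
      exact hasDerivAt_const _ _
  have hsum : HasDerivAt (fun s => logLik ν κ (φ s)) (∑ i, ∑ j, D i j) 0 := by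
    unfold logLik
    exact HasDerivAt.fun_sum fun i _ => HasDerivAt.fun_sum fun j _ => hD i j
  have hloc : IsLocalMax (fun s => logLik ν κ (φ s)) 0 :=
    Eventually.of_forall fun s => by
      change logLik ν κ (φ s) ≤ logLik ν κ (φ 0)
      rw [hφ0]
      exact hmax _
  have hzero := hloc.hasDerivAt_eq_zero hsum
  simp only [D, Finset.sum_sub_distrib] at hzero
  rw [Finset.sum_comm (f := fun i j => if j = g then if i ≠ g then
      κ (i, g) / noisePairProb ν θ i g * diffDensity v (ν i) (θ g - θ i) else 0 else 0)] at hzero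
  simp only [Finset.sum_ite_irrel, Finset.sum_const_zero, Finset.sum_ite_eq', Finset.mem_univ,
    if_true] at hzero
  rw [← Finset.sum_sub_distrib, ← Finset.add_sum_erase _ _ (Finset.mem_univ g)] at hzero
  simp only [ne_eq, not_true_eq_false, if_false, sub_self, zero_add] at hzero
  rw [← hzero]
  refine Finset.sum_congr rfl fun j hj => ?_
  simp only [Finset.ne_of_mem_erase hj, not_false_eq_true, if_true]
  ring

end FirstOrder

/-! ### The first order condition forced by consistency -/

section Expected

variable {m : ℕ} {ν : Fin m → Measure ℝ} {π : Fin m → ℝ → ℝ} {v : ℝ≥0} {g : Fin m}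

lemma expComparison_congr (T : Finset (Fin m)) (w : ℕ → ℕ → ℝ) {θ θ' : Fin m → ℝ}
    (h : ∀ i j, θ i - θ j = θ' i - θ' j) (i j : Fin m) :
    expComparison ν T w θ i j = expComparison ν T w θ' i j := by
  have hlt : ∀ (ξ : Fin m → ℝ) a b, (ξ + θ) a < (ξ + θ) b ↔ (ξ + θ') a < (ξ + θ') b := by
    intro ξ a b
    have := h a b
    simp only [Pi.add_apply]
    constructor <;> intro <;> linarith
  simp only [expComparison, utilComparison, posIn, hlt]

/-- The first order condition that consistency imposes at every ground truth. -/
lemma IsConsistent.first_order_condition (hπ : ∀ i, IsUtilityShape (π i)) {G : Breaking m}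
    {W : CMLWeights m} (hW : W.IsUniform) (h : IsConsistent G W π) (hv : v ≠ 0)
    (hg : π g = gaussianPDFReal 0 v) (θ : Fin m → ℝ) :
    ∑ j ∈ Finset.univ.erase g, diffDensity v (noiseLaw π j) (θ g - θ j) *
      (expComparison (noiseLaw π) Finset.univ G.extWeight θ g j / noisePairProb (noiseLaw π) θ g j
      - expComparison (noiseLaw π) Finset.univ G.extWeight θ j g / noisePairProb (noiseLaw π) θ j g)
      = 0 := by
  have : ∀ i, IsProbabilityMeasure (noiseLaw π i) := fun i => (hπ i).isProbabilityMeasure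
  have : ∀ i, NullSingletonClass (noiseLaw π i) := fun i => nullSingletonClass_shapeLaw _
  have : ∀ i, (noiseLaw π i).IsOpenPosMeasure := fun i => (hπ i).isOpenPosMeasure
  -- Moving the coordinate `g` may leave the parameter space. Subtracting the last coordinate
  -- returns to it without changing any difference, hence without changing the likelihood or the
  -- limit weights.
  let l : Fin m := ⟨m - 1, by have := g.pos; omega⟩
  have hshift : ∀ θ : Fin m → ℝ, (fun i => θ i - θ l) ∈ paramSpace m := by
    intro θ i hi
    have : i = l := Fin.ext (by simp only [l]; omega)
    simp [this]
  refine RBCML.first_order_condition (ν := noiseLaw π)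
    (κ := limitWeights (noiseLaw π) G θ) hv ?_ fun θ' => ?_
  · rw [noiseLaw, hg, shapeLaw_gaussian hv]
  · have h1 := h.logLik_le hπ hW (hshift θ) (hshift θ')
    have h2 : limitWeights (noiseLaw π) G (fun i => θ i - θ l) = limitWeights (noiseLaw π) G θ := by
      ext ij
      exact expComparison_congr _ _ (fun i j => by ring) _ _
    rw [h2] at h1
    rwa [logLik_congr _ (θ := fun i => θ i - θ l) (θ' := θ) (fun i j => by ring),
      logLik_congr _ (θ := fun i => θ' i - θ' l) (θ' := θ') (fun i j => by ring)] at h1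

end Expected

/-! ### Sending alternatives to infinity -/

section Separation

variable {m : ℕ} {ν : Fin m → Measure ℝ}

/-- Alternatives outside of `T` that are moved far up or far down only shift the positions of the
alternatives in `T`. -/
lemma eventually_posIn_add {T U : Finset (Fin m)} (hTU : Disjoint T U) {σ : Fin m → ℝ}
    (hT : ∀ i ∈ T, σ i = 0) (hU : ∀ i ∈ U, 0 < σ i) (hD : ∀ i, i ∉ T → i ∉ U → σ i < 0)
    (u : Fin m → ℝ) :
    ∀ᶠ M : ℝ in atTop, ∀ i ∈ T, posIn Finset.univ (u + M • σ) i = U.card + posIn T u i := by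
  have hup : ∀ᶠ M : ℝ in atTop, ∀ i, ∀ i' ∈ U, u i < u i' + M * σ i' := by
    simp only [eventually_all]
    intro i i' hi'
    have := tendsto_atTop_add_const_left atTop (u i') (tendsto_id.atTop_mul_const (hU i' hi'))
    exact this.eventually_gt_atTop (u i)
  have hdown : ∀ᶠ M : ℝ in atTop, ∀ i i', i' ∉ T → i' ∉ U → u i' + M * σ i' < u i := by
    simp only [eventually_all]
    intro i i' hi' hi''
    have := tendsto_atBot_add_const_left atTop (u i')
      (tendsto_id.atTop_mul_const_of_neg (hD i' hi' hi''))
    exact this.eventually_lt_atBot (u i)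
  filter_upwards [hup, hdown] with M h1 h2 i hi
  have hset : (Finset.univ.filter fun i' => (u + M • σ) i < (u + M • σ) i')
      = U ∪ T.filter fun i' => u i < u i' := by
    ext i'
    simp only [Finset.mem_filter, Finset.mem_univ, true_and, Finset.mem_union, Pi.add_apply,
      Pi.smul_apply, smul_eq_mul, hT i hi, mul_zero, add_zero]
    by_cases hi'T : i' ∈ T
    · have : i' ∉ U := Finset.disjoint_left.1 hTU hi'T
      simp [hi'T, this, hT i' hi'T]
    · by_cases hi'U : i' ∈ U
      · simp [hi'U, h1 i i' hi'U]
      · simp [hi'U, hi'T, (h2 i i' hi'T hi'U).le]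
  rw [posIn, hset, Finset.card_union_of_disjoint
    (hTU.symm.mono_right (Finset.filter_subset _ _)), posIn]

variable [∀ i, IsProbabilityMeasure (ν i)]

/-- For each fixed noise the positions in `T` are eventually exact offsets by `U.card`, so the
bounded integrands are eventually constant. -/
lemma tendsto_expComparison_separated {T U : Finset (Fin m)} (hTU : Disjoint T U) {σ : Fin m → ℝ}
    (hT : ∀ i ∈ T, σ i = 0) (hU : ∀ i ∈ U, 0 < σ i) (hD : ∀ i, i ∉ T → i ∉ U → σ i < 0)
    {w : ℕ → ℕ → ℝ} {C : ℝ} (hw : ∀ a b, |w a b| ≤ C) (θ : Fin m → ℝ) {i j : Fin m} (hi : i ∈ T)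
    (hj : j ∈ T) :
    Tendsto (fun M : ℝ => expComparison ν Finset.univ w (θ + M • σ) i j) atTop
      (𝓝 (expComparison ν T (fun a b => w (U.card + a) (U.card + b)) θ i j)) := by
  refine tendsto_integral_filter_of_dominated_convergence (fun _ => C)
    (Eventually.of_forall fun M => (integrable_utilComparison _ hw _ _ _).aestronglyMeasurable)
    (Eventually.of_forall fun M => ae_of_all _ fun ξ => ?_) (integrable_const _)
    (ae_of_all _ fun ξ => tendsto_const_nhds.congr' ?_)
  · refine (abs_utilComparison_le hw _ i j).trans ?_
    exact Set.indicator_le_self' (fun _ _ => (abs_nonneg _).trans (hw 0 0)) _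
  · filter_upwards [eventually_posIn_add hTU hT hU hD (ξ + θ)] with M hM
    simp only [utilComparison]
    rw [← add_assoc, hM i hi, hM j hj]
    simp [hT i hi, hT j hj]

lemma abs_expComparison_div_le (T : Finset (Fin m)) {w : ℕ → ℕ → ℝ} {C : ℝ}
    (hw : ∀ a b, |w a b| ≤ C) (θ : Fin m → ℝ) (i j : Fin m) :
    |expComparison ν T w θ i j / noisePairProb ν θ i j| ≤ C := by
  rw [abs_div, abs_of_nonneg (noisePairProb_nonneg θ i j)]
  exact div_le_of_le_mul₀ (noisePairProb_nonneg θ i j) ((abs_nonneg _).trans (hw 0 0))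
    (abs_expComparison_le T hw θ i j)

/-- The difference of the expected weights of the two outcomes of the comparison of `i` and `j`,
each given that outcome. -/
noncomputable def outcomeGap (ν : Fin m → Measure ℝ) (T : Finset (Fin m)) (w : ℕ → ℕ → ℝ)
    (θ : Fin m → ℝ) (i j : Fin m) : ℝ :=
  expComparison ν T w θ i j / noisePairProb ν θ i j
    - expComparison ν T w θ j i / noisePairProb ν θ j i

/-- The first order condition in the direction of alternative `g`, which has Gaussian noise of
variance `v`. -/
def FirstOrderCondition (ν : Fin m → Measure ℝ) (v : ℝ≥0) (g : Fin m) (w : ℕ → ℕ → ℝ) : Prop :=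
  ∀ θ : Fin m → ℝ, ∑ j ∈ Finset.univ.erase g,
    diffDensity v (ν j) (θ g - θ j) * outcomeGap ν Finset.univ w θ g j = 0

variable {v : ℝ≥0} {g : Fin m}

/-- The first order condition for a subset of the alternatives, whose positions are offset by
`U.card`. -/
lemma FirstOrderCondition.restrict {w : ℕ → ℕ → ℝ} {C : ℝ} (hw : ∀ a b, |w a b| ≤ C)
    (h : FirstOrderCondition ν v g w) (hv : v ≠ 0) {S U : Finset (Fin m)} (hgS : g ∉ S)
    (hgU : g ∉ U) (hSU : Disjoint S U) (θ : Fin m → ℝ) :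
    ∑ j ∈ S, diffDensity v (ν j) (θ g - θ j) *
      outcomeGap ν (insert g S) (fun a b => w (U.card + a) (U.card + b)) θ g j = 0 := by
  set T := insert g S with hTdef
  have hTU : Disjoint T U := Finset.disjoint_insert_left.2 ⟨hgU, hSU⟩
  -- Keep `T` in place, send `U` up and everything else down.
  set σ : Fin m → ℝ := fun i => if i ∈ T then 0 else if i ∈ U then 1 else -1 with hσ
  have hσT : ∀ i ∈ T, σ i = 0 := fun i hi => by simp [hσ, hi]
  have hσU : ∀ i ∈ U, 0 < σ i := fun i hi => by
    simp [hσ, Finset.disjoint_right.1 hTU hi, hi]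
  have hσD : ∀ i, i ∉ T → i ∉ U → σ i < 0 := fun i hi hi' => by simp [hσ, hi, hi']
  have hgT : g ∈ T := Finset.mem_insert_self _ _
  have hpair : ∀ M : ℝ, ∀ i ∈ T, ∀ j ∈ T,
      noisePairProb ν (θ + M • σ) i j = noisePairProb ν θ i j := by
    intro M i hi j hj
    refine noisePairProb_congr ?_
    simp [hσT i hi, hσT j hj]
  have hlim : ∀ j ∈ Finset.univ.erase g, Tendsto (fun M : ℝ =>
      diffDensity v (ν j) ((θ + M • σ) g - (θ + M • σ) j) *
        outcomeGap ν Finset.univ w (θ + M • σ) g j) atTop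
      (𝓝 (if j ∈ S then diffDensity v (ν j) (θ g - θ j) *
        outcomeGap ν T (fun a b => w (U.card + a) (U.card + b)) θ g j else 0)) := by
    intro j hj
    have hjg : j ≠ g := Finset.ne_of_mem_erase hj
    by_cases hjS : j ∈ S
    · have hjT : j ∈ T := Finset.mem_insert_of_mem hjS
      simp only [hjS, if_true, outcomeGap, hpair _ g hgT j hjT, hpair _ j hjT g hgT]
      have harg : ∀ M : ℝ, (θ + M • σ) g - (θ + M • σ) j = θ g - θ j := fun M => by
        simp [hσT g hgT, hσT j hjT]
      simp only [harg]
      exact ((tendsto_expComparison_separated hTU hσT hσU hσD hw θ hgT hjT).div_const _ |>.sub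
        ((tendsto_expComparison_separated hTU hσT hσU hσD hw θ hjT hgT).div_const _)).const_mul _
    -- For an alternative sent away the density tends to zero while the gap stays within `C + C`, so
    -- its term vanishes in the limit.
    · simp only [hjS, if_false]
      have hjT : j ∉ T := by simp [hTdef, hjg, hjS]
      have hσj : σ j ≠ 0 := by
        simp only [hσ, hjT, if_false]
        split_ifs <;> norm_num
      have harg : Tendsto (fun M : ℝ => (θ + M • σ) g - (θ + M • σ) j) atTop (cocompact ℝ) := by
        have h1 : Tendsto (fun M : ℝ => M) atTop (cocompact ℝ) := by
          rw [cocompact_eq_atBot_atTop]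
          exact tendsto_id.mono_right le_sup_right
        have h2 := (Homeomorph.mulRight₀ (-σ j) (neg_ne_zero.2 hσj)).isClosedEmbedding
          |>.tendsto_cocompact
        have h3 := (Homeomorph.addLeft (θ g - θ j)).isClosedEmbedding.tendsto_cocompact
        refine (h3.comp (h2.comp h1)).congr fun M => ?_
        simp only [Function.comp_apply, Homeomorph.coe_addLeft, Homeomorph.coe_mulRight₀,
          Pi.add_apply, Pi.smul_apply, smul_eq_mul, hσT g hgT]
        ring
      refine ((tendsto_diffDensity_cocompact hv (ν j)).comp harg).zero_mul_isBoundedUnder_le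
        (isBoundedUnder_of ⟨C + C, fun M => ?_⟩)
      simp only [Function.comp_apply, outcomeGap, Real.norm_eq_abs]
      exact (abs_sub _ _).trans (add_le_add (abs_expComparison_div_le _ hw _ _ _)
        (abs_expComparison_div_le _ hw _ _ _))
  have hsum := tendsto_finsetSum _ hlim
  have h0 : ∑ j ∈ Finset.univ.erase g, (if j ∈ S then diffDensity v (ν j) (θ g - θ j) *
      outcomeGap ν T (fun a b => w (U.card + a) (U.card + b)) θ g j else 0) = 0 := by
    refine tendsto_nhds_unique hsum ?_
    simp only [h _]
    exact tendsto_const_nhds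
  rw [← h0, Finset.sum_ite, Finset.sum_const_zero, add_zero]
  refine Finset.sum_congr ?_ fun _ _ => rfl
  ext j
  simp only [Finset.mem_filter, Finset.mem_erase, Finset.mem_univ, and_true]
  exact ⟨fun hj => ⟨fun h => hgS (h ▸ hj), hj⟩, fun hj => hj.2⟩

end Separation

/-! ### A second defeat of a rising Gaussian alternative is negligible -/

section Tail

variable {m : ℕ} {ν : Fin m → Measure ℝ} [∀ i, IsProbabilityMeasure (ν i)] {v : ℝ≥0} {g : Fin m}

lemma tendsto_noisePairProb_single {j : Fin m} (hj : j ≠ g) :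
    Tendsto (fun L : ℝ => noisePairProb ν (Pi.single g L) g j) atTop (𝓝 1) := by
  have h : Tendsto (fun L : ℝ => noisePairProb ν (Pi.single g L) g j) atTop
      (𝓝 ((Measure.pi ν).real Set.univ)) := by
    refine (ENNReal.tendsto_toReal (measure_ne_top _ _)).comp
      (tendsto_measure_of_ae_tendsto_indicator_of_isFiniteMeasure atTop MeasurableSet.univ
        (fun L => measurableSet_pair _ g j) (ae_of_all _ fun ξ => ?_))
    filter_upwards [eventually_gt_atTop (ξ j - ξ g)] with L hL
    simp only [Set.mem_univ, iff_true, Pi.single_eq_same,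
      Pi.single_eq_of_ne hj]
    linarith
  rwa [probReal_univ] at h

lemma noise_real_Ioi_inter {i j l : Fin m} (hil : i ≠ l) (hjl : j ≠ l) (θ : Fin m → ℝ) (K : ℝ) :
    (Measure.pi ν).real {ξ | ξ j + θ j < ξ i + θ i ∧ K < ξ l}
      = noisePairProb ν θ i j * (ν l).real (Set.Ioi K) := by
  have hind := (iIndepFun_noise (ν := ν)).indepFun_prodMk (fun i => measurable_pi_apply i)
    i j l hil hjl
  have hs : MeasurableSet {p : ℝ × ℝ | p.2 + θ j < p.1 + θ i} :=
    measurableSet_lt (by fun_prop) (by fun_prop)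
  have h := hind.measure_inter_preimage_eq_mul _ _ hs (measurableSet_Ioi (a := K))
  rw [← noise_real_eval (ν := ν) l measurableSet_Ioi, noisePairProb, measureReal_def,
    measureReal_def, measureReal_def, ← ENNReal.toReal_mul]
  congr 1

variable [∀ i, (ν i).IsOpenPosMeasure]

/-- As `g`, which has Gaussian noise, moves up, the probability that it is beaten by both `j` and
`l` becomes negligible compared with the probability that it is beaten by `j`. -/
lemma tendsto_beaten_twice (hv : v ≠ 0) (hg : ν g = gaussianReal 0 v) {j l : Fin m} (hj : j ≠ g)
    (hl : l ≠ g) (hjl : j ≠ l) :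
    Tendsto (fun L : ℝ => (Measure.pi ν).real {ξ | ξ g + L < ξ j ∧ ξ g + L < ξ l}
      / noisePairProb ν (Pi.single g L) j g) atTop (𝓝 0) := by
  have hv' : (0 : ℝ) < v := by exact_mod_cast pos_iff_ne_zero.2 hv
  have hpair : ∀ L, noisePairProb ν (Pi.single g L) j g
      = (Measure.pi ν).real {ξ | ξ g + L < ξ j} := fun L => by
    simp [noisePairProb, Pi.single_eq_of_ne hj]
  have htail : ∀ K, 0 < (ν j).real (Set.Ioi K) := fun K =>
    ENNReal.toReal_pos (isOpen_Ioi.measure_pos _ ⟨K + 1, by simp⟩).ne' (measure_ne_top _ _)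
  -- Split at a level `K`: either `ξ l` exceeds it, independently of the comparison of `g` and `j`,
  -- or `ξ g` is below `K - L`. The second event is compared with `ξ g < K - L + 1` and `ξ j > K +
  -- 1`, where `j` already wins; one unit of slack gains an exponential factor. `K` is fixed before
  -- `L` grows.
  have hbound : ∀ K L : ℝ, (Measure.pi ν).real {ξ | ξ g + L < ξ j ∧ ξ g + L < ξ l}
      / noisePairProb ν (Pi.single g L) j g ≤ (ν l).real (Set.Ioi K)
        + Real.exp ((2 * (K - L) + 1) / (2 * v)) / (ν j).real (Set.Ioi (K + 1)) := by
    intro K L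
    have hA := noisePairProb_pos (ν := ν) (Pi.single g L) hj
    have h1 : (Measure.pi ν).real {ξ | ξ g + L < ξ j ∧ ξ g + L < ξ l}
        ≤ noisePairProb ν (Pi.single g L) j g * (ν l).real (Set.Ioi K)
          + (gaussianReal 0 v).real (Set.Iio (K - L)) := by
      rw [← noise_real_Ioi_inter hjl hl.symm, ← hg, ← noise_real_eval g measurableSet_Iio]
      refine (measureReal_mono (fun ξ hξ => ?_)).trans (measureReal_union_le _ _)
      simp only [Set.mem_ofPred_eq, Set.mem_union, Set.mem_Iio, Pi.single_eq_same,
        Pi.single_eq_of_ne hj, add_zero] at hξ ⊢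
      by_cases hK : K < ξ l
      · exact Or.inl ⟨hξ.1, hK⟩
      · exact Or.inr (by linarith [hξ.2])
    have h2 : (gaussianReal 0 v).real (Set.Iio (K - L + 1)) * (ν j).real (Set.Ioi (K + 1))
        ≤ noisePairProb ν (Pi.single g L) j g := by
      rw [← hg, ← noise_real_inter hj.symm measurableSet_Iio measurableSet_Ioi, hpair]
      refine measureReal_mono fun ξ hξ => ?_
      simp only [Set.mem_ofPred_eq, Set.mem_Iio, Set.mem_Ioi] at hξ ⊢
      linarith [hξ.1, hξ.2]
    have h3 := gaussianReal_Iio_le hv (K - L)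
    have h4 : (gaussianReal 0 v).real (Set.Iio (K - L))
        ≤ Real.exp ((2 * (K - L) + 1) / (2 * v)) / (ν j).real (Set.Ioi (K + 1))
          * noisePairProb ν (Pi.single g L) j g := by
      refine h3.trans ?_
      rw [div_mul_eq_mul_div, mul_div_assoc]
      exact mul_le_mul_of_nonneg_left ((le_div_iff₀ (htail _)).2 h2) (Real.exp_pos _).le
    rw [div_le_iff₀ hA, add_mul]
    linarith [mul_comm (noisePairProb ν (Pi.single g L) j g) ((ν l).real (Set.Ioi K))]
  refine tendsto_order.2 ⟨fun a ha => Eventually.of_forall fun L => ha.trans_le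
    (div_nonneg measureReal_nonneg (noisePairProb_nonneg _ _ _)), fun ε hε => ?_⟩
  have hK : Tendsto (fun K : ℝ => (ν l).real (Set.Ioi K)) atTop (𝓝 ((ν l).real ∅)) := by
    refine (ENNReal.tendsto_toReal (measure_ne_top _ _)).comp
      (tendsto_measure_of_ae_tendsto_indicator_of_isFiniteMeasure atTop MeasurableSet.empty
        (fun K => measurableSet_Ioi) (ae_of_all _ fun x => ?_))
    filter_upwards [eventually_ge_atTop x] with K hK
    simpa using hK
  rw [measureReal_empty] at hK
  obtain ⟨K, hK⟩ := (hK.eventually (gt_mem_nhds (half_pos hε))).exists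
  have hexp : Tendsto (fun L : ℝ => Real.exp ((2 * (K - L) + 1) / (2 * v))
      / (ν j).real (Set.Ioi (K + 1))) atTop (𝓝 0) := by
    rw [← zero_div ((ν j).real (Set.Ioi (K + 1)))]
    refine (Real.tendsto_exp_atBot.comp ?_).div_const _
    refine Tendsto.atBot_div_const (by positivity) ?_
    refine tendsto_atBot_add_const_right _ _ (Tendsto.const_mul_atBot two_pos ?_)
    exact tendsto_atBot_add_const_left _ K tendsto_neg_atTop_atBot
  filter_upwards [hexp.eventually (gt_mem_nhds (half_pos hε))] with L hL
  linarith [hbound K L]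

end Tail

/-! ### Equality of weights sharing the upper position -/

section Limit

variable {m : ℕ} {ν : Fin m → Measure ℝ} [∀ i, IsProbabilityMeasure (ν i)] {v : ℝ≥0} {g : Fin m}

lemma posIn_insert_self {S : Finset (Fin m)} (u : Fin m → ℝ) :
    posIn (insert g S) u g = posIn S u g := by
  simp [posIn, Finset.filter_insert]

/-- The probability that `j` is at the bottom of `S`. -/
noncomputable def bottomProb (ν : Fin m → Measure ℝ) (S : Finset (Fin m)) (j : Fin m) : ℝ :=
  (Measure.pi ν).real {ξ | posIn S ξ j + 1 = S.card}

lemma bottomProb_pos [∀ i, (ν i).IsOpenPosMeasure] {S : Finset (Fin m)} {j : Fin m} (hj : j ∈ S) :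
    0 < bottomProb ν S j := by
  have hop : IsOpen {ξ : Fin m → ℝ | ∀ l ∈ S.erase j, ξ j < ξ l} := by
    have : {ξ : Fin m → ℝ | ∀ l ∈ S.erase j, ξ j < ξ l}
        = ⋂ l ∈ S.erase j, {ξ : Fin m → ℝ | ξ j < ξ l} := by
      ext ξ; simp
    rw [this]
    exact isOpen_biInter_finset fun l _ => isOpen_lt (by fun_prop) (by fun_prop)
  refine (noise_real_pos_of_isOpen (ν := ν) hop ⟨Pi.single j (-1), fun l hl => ?_⟩).trans_le
    (measureReal_mono fun ξ hξ => ?_)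
  · simp [Pi.single_eq_of_ne (Finset.ne_of_mem_erase hl)]
  · have : (S.filter fun l => ξ j < ξ l) = S.erase j := by
      ext l
      simp only [Finset.mem_filter, Finset.mem_erase]
      refine ⟨fun h => ⟨?_, h.1⟩, fun h => ⟨h.2, hξ l (Finset.mem_erase.2 h)⟩⟩
      rintro rfl
      exact lt_irrefl _ h.2
    change posIn S ξ j + 1 = S.card
    rw [posIn, this, Finset.card_erase_add_one hj]

variable {S : Finset (Fin m)} {h : ℕ → ℕ → ℝ} {C : ℝ}

/-- If `g` is moved up, it is at the top. -/
lemma tendsto_expComparison_top (hgS : g ∉ S) (hC : ∀ a b, |h a b| ≤ C)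
    (h0 : ∀ r, 1 ≤ r → r < S.card → h 0 r = 0) {j : Fin m} (hj : j ∈ S) :
    Tendsto (fun L : ℝ => expComparison ν (insert g S) h (Pi.single g L) g j) atTop
      (𝓝 (bottomProb ν S j * h 0 S.card)) := by
  have hjg : j ≠ g := fun e => hgS (e ▸ hj)
  have hms : MeasurableSet {ξ : Fin m → ℝ | posIn S ξ j + 1 = S.card} :=
    measurableSet_eq_fun ((measurable_posIn S j).add_const 1) measurable_const
  have hlim : bottomProb ν S j * h 0 S.card = ∫ ξ, {ξ : Fin m → ℝ | posIn S ξ j + 1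
      = S.card}.indicator (fun _ => h 0 S.card) ξ ∂Measure.pi ν := by
    rw [integral_indicator_const _ hms, smul_eq_mul, bottomProb]
  rw [hlim]
  refine tendsto_integral_filter_of_dominated_convergence (fun _ => C)
    (Eventually.of_forall fun M => (integrable_utilComparison _ hC _ _ _).aestronglyMeasurable)
    (Eventually.of_forall fun M => ae_of_all _ fun ξ => ?_) (integrable_const _)
    (ae_of_all _ fun ξ => tendsto_const_nhds.congr' ?_)
  · refine (abs_utilComparison_le hC _ g j).trans ?_
    exact Set.indicator_le_self' (fun _ _ => (abs_nonneg _).trans (hC 0 0)) _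
  · have hev : ∀ᶠ L : ℝ in atTop, ∀ i, ξ i - ξ g < L := by
      simp only [eventually_all]
      exact fun i => eventually_gt_atTop _
    filter_upwards [hev] with L hL
    have hne : ∀ i ∈ S, i ≠ g := fun i hi e => hgS (e ▸ hi)
    have hS : ∀ i ∈ S, (ξ + Pi.single g L : Fin m → ℝ) i = ξ i := fun i hi => by
      simp [Pi.single_eq_of_ne (hne i hi)]
    have hg' : (ξ + Pi.single g L : Fin m → ℝ) g = ξ g + L := by simp
    have hlt : ∀ i ∈ S, (ξ + Pi.single g L : Fin m → ℝ) i < (ξ + Pi.single g L : Fin m → ℝ) g := by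
      intro i hi
      rw [hS i hi, hg']
      linarith [hL i]
    have hposg : posIn (insert g S) (ξ + Pi.single g L) g = 0 := by
      rw [posIn_insert_self, posIn, Finset.card_eq_zero, Finset.filter_eq_empty_iff]
      exact fun i hi => (hlt i hi).le.not_gt
    have hposj : posIn (insert g S) (ξ + Pi.single g L) j = posIn S ξ j + 1 := by
      have hfil : (S.filter fun i => (ξ + Pi.single g L : Fin m → ℝ) j
          < (ξ + Pi.single g L : Fin m → ℝ) i) = S.filter fun i => ξ j < ξ i := by
        refine Finset.filter_congr fun i hi => ?_
        rw [hS i hi, hS j hj]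
      rw [posIn, Finset.filter_insert, if_pos (hlt j hj), hfil, Finset.card_insert_of_notMem, posIn]
      simp [hgS]
    -- With `g` on top, `j` is one place lower than within `S`; by `h0` only the bottom place,
    -- `S.card`, can carry weight.
    simp only [utilComparison, hlt j hj, if_true, hposg, hposj, Set.indicator, Set.mem_ofPred_eq]
    split_ifs with hb
    · rw [hb]
    · have := posIn_lt_card (u := ξ) hj
      exact (h0 _ (by omega) (by omega)).symm

variable [∀ i, (ν i).IsOpenPosMeasure]

/-- If `g` is moved up and is nevertheless beaten by `j`, then it is directly below `j` at the
top. -/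
lemma tendsto_expComparison_div_beaten (hv : v ≠ 0) (hg : ν g = gaussianReal 0 v) (hgS : g ∉ S)
    (hC : ∀ a b, |h a b| ≤ C) (h01 : h 0 1 = 0) {j : Fin m} (hj : j ∈ S) :
    Tendsto (fun L : ℝ => expComparison ν (insert g S) h (Pi.single g L) j g
      / noisePairProb ν (Pi.single g L) j g) atTop (𝓝 0) := by
  have hjg : j ≠ g := fun e => hgS (e ▸ hj)
  have hC0 : 0 ≤ C := (abs_nonneg _).trans (hC 0 0)
  set B : Fin m → ℝ → Set (Fin m → ℝ) := fun l L => {ξ | ξ g + L < ξ j ∧ ξ g + L < ξ l} with hB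
  have hBm : ∀ l L, MeasurableSet (B l L) := fun l L => by
    change MeasurableSet ({ξ : Fin m → ℝ | ξ g + L < ξ j} ∩ {ξ : Fin m → ℝ | ξ g + L < ξ l})
    exact (measurableSet_lt (by fun_prop) (by fun_prop)).inter
      (measurableSet_lt (by fun_prop) (by fun_prop))
  -- If `j` alone beats `g`, their positions are `0` and `1`, where `h` vanishes. Only a second
  -- winner `l` lets the integrand be nonzero.
  have hpt : ∀ (L : ℝ) (ξ : Fin m → ℝ),
      |utilComparison (insert g S) h (ξ + Pi.single g L) j g|
        ≤ ∑ l ∈ S.erase j, (B l L).indicator (fun _ => C) ξ := by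
    intro L ξ
    have hnn : ∀ l ∈ S.erase j, 0 ≤ (B l L).indicator (fun _ => C) ξ := fun l _ =>
      Set.indicator_nonneg (fun _ _ => hC0) _
    have hgL : (ξ + Pi.single g L : Fin m → ℝ) g = ξ g + L := by simp
    have hS : ∀ i ∈ S, (ξ + Pi.single g L : Fin m → ℝ) i = ξ i := fun i hi => by
      simp [Pi.single_eq_of_ne (fun e : i = g => hgS (e ▸ hi))]
    by_cases hlt : ξ g + L < ξ j
    swap
    · have : ¬ (ξ + Pi.single g L : Fin m → ℝ) g < (ξ + Pi.single g L : Fin m → ℝ) j := by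
        rwa [hgL, hS j hj]
      simpa only [utilComparison, this, if_false, abs_zero] using Finset.sum_nonneg hnn
    by_cases hex : ∃ l ∈ S.erase j, ξ g + L < ξ l
    · obtain ⟨l, hl, hl'⟩ := hex
      refine le_trans ?_ (Finset.single_le_sum hnn hl)
      rw [Set.indicator_of_mem (show ξ ∈ B l L from ⟨hlt, hl'⟩)]
      refine (abs_utilComparison_le hC _ j g).trans ?_
      exact Set.indicator_le_self' (fun _ _ => hC0) _
    · push Not at hex
      have hposg : posIn (insert g S) (ξ + Pi.single g L) g = 1 := by
        rw [posIn_insert_self, posIn, Finset.card_eq_one]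
        refine ⟨j, ?_⟩
        ext i
        simp only [Finset.mem_filter, Finset.mem_singleton]
        refine ⟨fun hi => ?_, ?_⟩
        · by_contra hij
          have := hi.2
          rw [hgL, hS i hi.1] at this
          exact (hex i (Finset.mem_erase.2 ⟨hij, hi.1⟩)).not_gt this
        · rintro rfl
          exact ⟨hj, by rwa [hgL, hS i hj]⟩
      have hposj : posIn (insert g S) (ξ + Pi.single g L) j = 0 := by
        have hlt' : (ξ + Pi.single g L : Fin m → ℝ) g < (ξ + Pi.single g L : Fin m → ℝ) j := by
          rwa [hgL, hS j hj]
        have := posIn_lt_posIn (T := insert g S) (Finset.mem_insert_of_mem hj) hlt'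
        omega
      have : utilComparison (insert g S) h (ξ + Pi.single g L) j g = 0 := by
        simp [utilComparison, hposg, hposj, h01]
      rw [this, abs_zero]
      exact Finset.sum_nonneg hnn
  have hbound : ∀ L : ℝ, ‖expComparison ν (insert g S) h (Pi.single g L) j g
      / noisePairProb ν (Pi.single g L) j g‖ ≤ ∑ l ∈ S.erase j, C *
        ((Measure.pi ν).real (B l L) / noisePairProb ν (Pi.single g L) j g) := by
    intro L
    rw [norm_div, Real.norm_of_nonneg (noisePairProb_nonneg _ _ _), Real.norm_eq_abs]
    simp only [← mul_div_assoc, ← Finset.sum_div]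
    refine div_le_div_of_nonneg_right ?_ (noisePairProb_nonneg _ _ _)
    calc |expComparison ν (insert g S) h (Pi.single g L) j g|
        ≤ ∫ ξ, |utilComparison (insert g S) h (ξ + (Pi.single g L : Fin m → ℝ)) j g| ∂Measure.pi ν :=
          abs_integral_le_integral_abs
      _ ≤ ∫ ξ, ∑ l ∈ S.erase j, (B l L).indicator (fun _ => C) ξ ∂Measure.pi ν :=
          integral_mono (integrable_utilComparison _ hC _ _ _).abs
            (integrable_finsetSum _ fun l _ => (integrable_const C).indicator (hBm l L)) (hpt L)
      _ = ∑ l ∈ S.erase j, C * (Measure.pi ν).real (B l L) := by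
          rw [integral_finsetSum _ fun l _ => (integrable_const C).indicator (hBm l L)]
          refine Finset.sum_congr rfl fun l _ => ?_
          rw [integral_indicator_const _ (hBm l L), smul_eq_mul, mul_comm]
  refine squeeze_zero_norm hbound ?_
  have hsum := tendsto_finsetSum (S.erase j) fun l hl =>
    (tendsto_beaten_twice (ν := ν) hv hg hjg (fun e => hgS (e ▸ Finset.mem_of_mem_erase hl))
      (Finset.ne_of_mem_erase hl).symm).const_mul C
  simpa using hsum

/-- The first order condition propagates equality of weights to larger distances of positions. -/
lemma FirstOrderCondition.weight_eq_of_lt {w : ℕ → ℕ → ℝ} (hw : ∀ a b, |w a b| ≤ C)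
    (hfoc : FirstOrderCondition ν v g w) (hv : v ≠ 0) (hg : ν g = gaussianReal 0 v) {k d : ℕ}
    (hd : 1 ≤ d) (hkd : k + d < m) (hlt : ∀ r, 1 ≤ r → r < d → w k (k + r) = w k (k + 1)) :
    w k (k + d) = w k (k + 1) := by
  -- Of these `k + d` alternatives, the `d` in `S` compete with `g` and the remaining `k` are sent
  -- to the top.
  obtain ⟨S', hS', hS'card⟩ := Finset.exists_subset_card_eq (s := Finset.univ.erase g) (n := k + d)
    (by rw [Finset.card_erase_of_mem (Finset.mem_univ g), Finset.card_univ, Fintype.card_fin]; omega)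
  obtain ⟨S, hS, hScard⟩ := Finset.exists_subset_card_eq (s := S') (n := d) (by omega)
  set U := S' \ S with hU
  have hUcard : U.card = k := by
    rw [hU, Finset.card_sdiff_of_subset hS]
    omega
  have hgS' : g ∉ S' := fun hm => Finset.notMem_erase g _ (hS' hm)
  have hgS : g ∉ S := fun hm => hgS' (hS hm)
  have hgU : g ∉ U := fun hm => hgS' (Finset.mem_sdiff.1 hm).1
  by_contra hne
  set c := w k (k + 1) with hc
  set h : ℕ → ℕ → ℝ := fun a b => w (k + a) (k + b) - c with hh
  have hC : ∀ a b, |h a b| ≤ C + C := fun a b =>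
    (abs_sub _ _).trans (add_le_add (hw _ _) (hw _ _))
  have hpos : ∀ (L : ℝ) i j, i ≠ j → 0 < noisePairProb ν (Pi.single g L) i j := fun L i j hij =>
    noisePairProb_pos (ν := ν) _ hij
  have hne' : ∀ j ∈ S, j ≠ g := fun j hj e => hgS (e ▸ hj)
  -- Subtracting `c` from all weights lowers both conditional means by `c`, leaving the gap
  -- unchanged.
  have hgap : ∀ (L : ℝ), ∀ j ∈ S, outcomeGap ν (insert g S) (fun a b => w (U.card + a) (U.card + b))
      (Pi.single g L) g j = outcomeGap ν (insert g S) h (Pi.single g L) g j := by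
    intro L j hj
    rw [hUcard]
    simp only [outcomeGap, hh]
    have e1 := expComparison_sub (ν := ν) (insert g S) (w := fun a b => w (k + a) (k + b))
      (w' := fun _ _ => c) (fun a b => hw _ _) (fun _ _ => hw _ _) (Pi.single g L) g j
    have e2 := expComparison_sub (ν := ν) (insert g S) (w := fun a b => w (k + a) (k + b))
      (w' := fun _ _ => c) (fun a b => hw _ _) (fun _ _ => hw _ _) (Pi.single g L) j g
    rw [e1, e2, expComparison_const, expComparison_const, sub_div, sub_div,
      mul_div_cancel_right₀ _ (hpos L g j (hne' j hj).symm).ne',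
      mul_div_cancel_right₀ _ (hpos L j g (hne' j hj)).ne']
    ring
  have hδ : h 0 S.card ≠ 0 := by
    simp only [hh, hScard, add_zero]
    exact sub_ne_zero.2 hne
  -- The factor `h 0 S.card` removes the case distinction on its sign. Since all terms share a sign,
  -- only positivity of the densities matters, not their behaviour as `L` grows.
  have hlim : ∀ j ∈ S, ∀ᶠ L : ℝ in atTop,
      0 < h 0 S.card * outcomeGap ν (insert g S) h (Pi.single g L) g j := by
    intro j hj
    have h1 := (tendsto_expComparison_top (ν := ν) hgS hC (fun r hr hr' => by
      simp only [hh, add_zero, sub_eq_zero]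
      exact hlt r hr (hScard ▸ hr')) hj).div
        (tendsto_noisePairProb_single (ν := ν) (hne' j hj)) one_ne_zero
    have h2 := tendsto_expComparison_div_beaten (ν := ν) hv hg hgS hC (by simp [hh, hc]) hj
    have h3 := (h1.sub h2).const_mul (h 0 S.card)
    refine h3.eventually (lt_mem_nhds ?_)
    have := mul_pos (bottomProb_pos (ν := ν) hj) (mul_self_pos.2 hδ)
    rw [div_one, sub_zero]
    linarith
  obtain ⟨L, hL⟩ := ((Finset.eventually_all S).2 hlim).exists
  have hsum := hfoc.restrict hw hv hgS hgU (hU ▸ Finset.disjoint_sdiff) (Pi.single g L)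
  have hpos' : 0 < ∑ j ∈ S, h 0 S.card * (diffDensity v (ν j)
      ((Pi.single g L : Fin m → ℝ) g - (Pi.single g L : Fin m → ℝ) j) *
      outcomeGap ν (insert g S) (fun a b => w (U.card + a) (U.card + b)) (Pi.single g L) g j) := by
    refine Finset.sum_pos (fun j hj => ?_) (Finset.card_pos.1 (by omega))
    rw [hgap L j hj, mul_left_comm]
    exact mul_pos (diffDensity_pos hv _ _) (hL j hj)
  rw [← Finset.mul_sum, hsum, mul_zero] at hpos'
  exact lt_irrefl _ hpos'

lemma FirstOrderCondition.weight_eq {w : ℕ → ℕ → ℝ} (hw : ∀ a b, |w a b| ≤ C)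
    (hfoc : FirstOrderCondition ν v g w) (hv : v ≠ 0) (hg : ν g = gaussianReal 0 v) (k d : ℕ)
    (hd : 1 ≤ d) (hkd : k + d < m) : w k (k + d) = w k (k + 1) := by
  induction d using Nat.strong_induction_on with
  | _ d ih => exact hfoc.weight_eq_of_lt hw hv hg hd hkd fun r hr hrd => ih r hrd hr (by omega)

end Limit

/-! ### Turning rankings upside down -/

section Reversal

variable {m : ℕ} {ν : Fin m → Measure ℝ} {v : ℝ≥0} {g : Fin m}

lemma diffDensity_neg {μ : Measure ℝ} (hμ : μ.map (fun x => -x) = μ) (t : ℝ) :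
    diffDensity v μ (-t) = diffDensity v μ t := by
  have h := (⟨measurable_neg, hμ⟩ : MeasurePreserving (fun x : ℝ => -x) μ μ).integral_comp
    (MeasurableEquiv.neg ℝ).measurableEmbedding (fun y => gaussianPDFReal 0 v (y - t))
  rw [diffDensity, diffDensity, ← h]
  congr 1 with y
  simp only [gaussianPDFReal]
  congr 3
  ring

variable [∀ i, IsProbabilityMeasure (ν i)]

lemma measurePreserving_neg_noise (hsymm : ∀ i, (ν i).map (fun x => -x) = ν i) :
    MeasurePreserving (fun ξ : Fin m → ℝ => -ξ) (Measure.pi ν) (Measure.pi ν) :=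
  measurePreserving_pi ν ν (f := fun _ x => -x) fun i => ⟨measurable_neg, hsymm i⟩

/-- The weights of the positions counted from the bottom. -/
def reverseWeight (m : ℕ) (w : ℕ → ℕ → ℝ) (a b : ℕ) : ℝ := w (m - 1 - a) (m - 1 - b)

lemma posIn_neg {u : Fin m → ℝ} (hu : Function.Injective u) (i : Fin m) :
    posIn Finset.univ (-u) i + posIn Finset.univ u i + 1 = m := by
  have h1 : (Finset.univ.filter fun i' => (-u) i < (-u) i')
      = Finset.univ.filter fun i' => u i' < u i := by simp
  have h2 : (Finset.univ.filter fun i' => u i' < u i)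
      = (Finset.univ.filter fun i' => ¬ u i < u i').erase i := by
    ext i'
    simp only [Finset.mem_filter, Finset.mem_univ, true_and, Finset.mem_erase, not_lt]
    refine ⟨fun h => ⟨?_, h.le⟩, fun h => lt_of_le_of_ne h.2 fun e => h.1 (hu e)⟩
    rintro rfl
    exact lt_irrefl _ h
  have h3 := Finset.card_filter_add_card_filter_not (s := (Finset.univ : Finset (Fin m)))
    (fun i' => u i < u i')
  have h4 : ((Finset.univ.filter fun i' => ¬ u i < u i').erase i).card + 1
      = (Finset.univ.filter fun i' => ¬ u i < u i').card :=
    Finset.card_erase_add_one (by simp)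
  rw [Finset.card_univ, Fintype.card_fin] at h3
  rw [posIn, posIn, h1, h2]
  omega

variable [∀ i, NullSingletonClass (ν i)]

/-- Negating the noise preserves its law, exchanges winner and loser, and reverses all positions
when there are no ties; symmetry of `w` absorbs the exchanged arguments. -/
lemma expComparison_reverse (hsymm : ∀ i, (ν i).map (fun x => -x) = ν i) {w : ℕ → ℕ → ℝ}
    (hw : ∀ a b, w a b = w b a) (θ : Fin m → ℝ) (i j : Fin m) :
    expComparison ν Finset.univ (reverseWeight m w) θ i j
      = expComparison ν Finset.univ w (-θ) j i := by
  have hneg := (measurePreserving_neg_noise hsymm).integral_comp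
    (MeasurableEquiv.neg (Fin m → ℝ)).measurableEmbedding
    (fun ξ => utilComparison Finset.univ (reverseWeight m w) (ξ + θ) i j)
  rw [expComparison, ← hneg, expComparison]
  refine integral_congr_ae ?_
  filter_upwards [ae_noise_injective (-θ)] with ξ hξ
  have hu : -ξ + θ = -(ξ + -θ) := by ring
  have hi := posIn_neg hξ i
  have hj := posIn_neg hξ j
  have hi' : m - 1 - posIn Finset.univ (-(ξ + -θ)) i = posIn Finset.univ (ξ + -θ) i := by omega
  have hj' : m - 1 - posIn Finset.univ (-(ξ + -θ)) j = posIn Finset.univ (ξ + -θ) j := by omega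
  rw [hu]
  simp only [utilComparison, reverseWeight, hi', hj', Pi.neg_apply (ξ + -θ), neg_lt_neg_iff]
  rw [hw]

lemma noisePairProb_reverse (hsymm : ∀ i, (ν i).map (fun x => -x) = ν i) (θ : Fin m → ℝ)
    (i j : Fin m) : noisePairProb ν θ i j = noisePairProb ν (-θ) j i := by
  have h := expComparison_reverse hsymm (w := fun _ _ => 1) (fun _ _ => rfl) θ i j
  have h1 : reverseWeight m (fun _ _ => (1 : ℝ)) = fun _ _ => 1 := rfl
  rw [h1, expComparison_const, expComparison_const] at h
  simpa using h

/-- At `-θ` the densities are the same, being even, and every gap changes sign; the vanishing of the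
sum is unaffected. -/
lemma FirstOrderCondition.reverse (hsymm : ∀ i, (ν i).map (fun x => -x) = ν i) {w : ℕ → ℕ → ℝ}
    (hw : ∀ a b, w a b = w b a) (h : FirstOrderCondition ν v g w) :
    FirstOrderCondition ν v g (reverseWeight m w) := by
  intro θ
  rw [← neg_eq_zero, ← h (-θ), ← Finset.sum_neg_distrib]
  refine Finset.sum_congr rfl fun j _ => ?_
  have : (-θ) g - (-θ) j = -(θ g - θ j) := by simp only [Pi.neg_apply]; ring
  rw [this, diffDensity_neg (hsymm j), outcomeGap, outcomeGap, expComparison_reverse hsymm hw,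
    expComparison_reverse hsymm hw, noisePairProb_reverse hsymm θ, noisePairProb_reverse hsymm θ]
  ring

end Reversal

/-! ### Consistency forces uniformity -/

section Necessity

variable {m : ℕ} {π : Fin m → ℝ → ℝ}

lemma IsConsistent.isUniform (hπ : ∀ i, IsUtilityShape (π i))
    (hsymm : ∀ i, IsSymmetricShape (π i)) (hgauss : ∃ i, IsGaussianShape (π i)) {G : Breaking m}
    {W : CMLWeights m} (hW : W.IsUniform) (h : IsConsistent G W π) : G.IsUniform := by
  have : ∀ i, IsProbabilityMeasure (noiseLaw π i) := fun i => (hπ i).isProbabilityMeasure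
  have : ∀ i, NullSingletonClass (noiseLaw π i) := fun i => nullSingletonClass_shapeLaw _
  have : ∀ i, (noiseLaw π i).IsOpenPosMeasure := fun i => (hπ i).isOpenPosMeasure
  obtain ⟨g, v, hv, hg⟩ := hgauss
  have hνg : noiseLaw π g = gaussianReal 0 v := by rw [noiseLaw, hg, shapeLaw_gaussian hv]
  have hνs : ∀ i, (noiseLaw π i).map (fun x => -x) = noiseLaw π i := fun i => (hsymm i).map_neg
  have hfoc : FirstOrderCondition (noiseLaw π) v g G.extWeight := fun θ =>
    h.first_order_condition hπ hW hv hg θ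
  obtain ⟨C, hC⟩ := G.exists_abs_extWeight_le
  have hdown : ∀ a b, a < b → b < m → G.extWeight a b = G.extWeight a (a + 1) := by
    intro a b hab hb
    have := hfoc.weight_eq hC hv hνg a (b - a) (by omega) (by omega)
    rwa [Nat.add_sub_cancel' hab.le] at this
  have hup : ∀ a b, a < b → b < m → G.extWeight a b = G.extWeight (b - 1) b := by
    intro a b hab hb
    have := (hfoc.reverse hνs G.extWeight_comm).weight_eq (C := C) (fun _ _ => hC _ _) hv hνg
      (m - 1 - b) (b - a) (by omega) (by omega)
    rw [show m - 1 - (m - 1 - b) = b by omega, show m - 1 - (m - 1 - b + (b - a)) = a by omega,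
      show m - 1 - (m - 1 - b + 1) = b - 1 by omega] at this
    rw [G.extWeight_comm a b, G.extWeight_comm (b - 1) b, this]
  -- Any pair `(a, b)` is linked to `(0, b)` by the common lower position, and `(0, b)` to `(0, 1)`
  -- by the common upper position.
  have hall : ∀ a b, a < b → b < m → G.extWeight a b = G.extWeight 0 1 := by
    intro a b hab hb
    rw [hup a b hab hb, ← hup 0 b (by omega) hb, hdown 0 b (by omega) hb]
  refine ⟨G.extWeight 0 1, fun k l hkl => ?_⟩
  rw [← G.extWeight_of_lt k.isLt l.isLt]
  rcases lt_or_gt_of_ne hkl with hlt | hlt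
  · exact hall k l hlt l.isLt
  · rw [G.extWeight_comm]
    exact hall l k hlt k.isLt

end Necessity

end RBCML

theorem mainTheorem10 (m : ℕ) (π : Fin m → ℝ → ℝ)
    (hπ : ∀ i, RBCML.IsUtilityShape (π i))
    (hsymm : ∀ i, RBCML.IsSymmetricShape (π i))
    (hgauss : ∃ i, RBCML.IsGaussianShape (π i))
    (G : RBCML.Breaking m) (hG : G.HasEdge)
    (W : RBCML.CMLWeights m) (hW : W.IsUniform) :
    RBCML.IsConsistent G W π ↔ G.IsUniform :=
  ⟨fun h => h.isUniform hπ hsymm hgauss hW, fun h => RBCML.isConsistent_of_isUniform hπ hG hW h⟩
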